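/- Let $(\mathcal S,\mathcal A,P,r,\mu,\gamma)$ be a finite Markov decision process with $\mathcal A\neq\emptyset$, rewards $r(s,a)\in[0,1]$, discount $\gamma\in[0,1)$ and initial distribution $\mu$ with $\mu(s)>0$ for all $s\in\mathcal S$; let $\lambda>0$. For a policy $\pi$ put $$V_\lambda^\pi(s)=\mathbb E_\pi\Big[\sum_{t\ge0}\gamma^t\Big(r(s_t,a_t)-\lambda\sum_{a}\pi(a|s_t)\log\pi(a|s_t)\Big)\Big|\,s_0=s\Big],\qquad J(\pi,\lambda)=V^\pi_\lambda(\mu)=\sum_s\mu(s)V_\lambda^\pi(s),$$ and $d_{\pi,\mu}(s)=(1-\gamma)\sum_{t\ge0}\gamma^t\,\mathbb P^\pi(s_t=s\mid s_0\sim\mu)$. Then a policy $\pi_\lambda^*$ maximizing $J(\cdot,\lambda)$ over all policies exists. For every such $\pi_\lambda^*$ the following holds; write $V_\lambda^*=V_\lambda^{\pi_\lambda^*}$. For $\theta\in\mathbb R^{\mathcal S\times\mathcal A}$ let $\pi_\theta(a|s)=e^{\theta(s,a)}/\sum_{a'}e^{\theta(s,a')}$. For any $\theta_0\in\mathbb R^{\mathcal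 S\times\mathcal A}$ run policy gradient $\theta_{t+1}=\theta_t+\eta\nabla_\theta J(\pi_{\theta},\lambda)|_{\theta=\theta_t}$ with learning rate $\eta=\frac{(1-\gamma)^3}{8+\lambda(4+8\log|\mathcal A|)}$, and write $\pi_t=\pi_{\theta_t}$. Let $$c_\lambda=\inf_{t\ge1}\min_{s,a}\pi_t(a|s)^2,\qquad C_\lambda=\frac{c_\lambda(1-\gamma)^4\min_s\mu(s)}{(8/\lambda+4+8\log|\mathcal A|)\,|\mathcal S|}\left\|\frac{d_{\pi^*_\lambda,\mu}}{\mu}\right\|_\infty^{-1},\qquad \mathrm{Time}(\lambda)=\frac1{C_\lambda}\log\left(\frac{4\|1/\mu\|_\infty}{1-\gamma}\right).$$ Then $C_\lambda>0$, and policy gradient satisfies Prop-I with $\hat\varepsilon=0$ in time $\mathrm{Time}(\lambda)$, time being counted in gradient iterations: for every $\theta_0$, every integer $T\ge\mathrm{Time}(\lambda)$ and every state $s$, $$V_\lambda^*(s)-V_\lambda^{\pi_T}(s)\le\tfrac14\left(V_\lambda^*(\mu)-V_\lambda^{\pi_0}(\mu)\right).$$ -/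

import Mathlib

noncomputable section

/-- A finite discounted Markov decision process with rewards in `[0, 1]`: transition
probabilities `P s a s'`, rewards `r s a`, initial state distribution `μ`, discount `γ ∈ [0, 1)`. -/
structure FiniteMDP (S A : Type*) [Fintype S] where
  P : S → A → S → ℝ
  P_mem : ∀ s a, P s a ∈ stdSimplex ℝ S
  r : S → A → ℝ
  r_mem : ∀ s a, r s a ∈ Set.Icc (0 : ℝ) 1
  μ : S → ℝ
  μ_mem : μ ∈ stdSimplex ℝ S
  γ : ℝ
  γ_mem : γ ∈ Set.Ico (0 : ℝ) 1

/-- A stationary randomized policy: `π s a` is the probability of action `a` in state `s`. -/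
def IsPolicy {S A : Type*} [Fintype A] (π : S → A → ℝ) : Prop :=
  ∀ s, π s ∈ stdSimplex ℝ A

/-- The regularizer `Ω(p) = ∑ a, p a log (p a)`, the negative Shannon entropy (`0 log 0 = 0`). -/
def negEntropy {A : Type*} [Fintype A] (p : A → ℝ) : ℝ :=
  ∑ a, p a * Real.log (p a)

/-- The softmax policy of the parameter `θ ∈ ℝ^(S × A)`. -/
def softmaxPolicy {S A : Type*} [Fintype A] (θ : EuclideanSpace ℝ (S × A)) : S → A → ℝ :=
  fun s a => Real.exp (θ (s, a)) / ∑ a', Real.exp (θ (s, a'))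

namespace FiniteMDP

variable {S A : Type*} [Fintype S] [DecidableEq S] [Fintype A] (M : FiniteMDP S A)

/-- The one-step state transition matrix under `π`. Its `t`-th power has the entries
`ℙ^π (s_t = s' | s_0 = s)`. -/
def transMatrix (π : S → A → ℝ) : Matrix S S ℝ :=
  Matrix.of fun s s' => ∑ a, π s a * M.P s a s'

/-- `V_lam^π(s) = 𝔼[∑_t γ^t (r(s_t, a_t) - lam Ω(π(·|s_t))) | s_0 = s]`, the expectation of the
`t`-th term being taken under the law of `(s_t, a_t)`. -/
def value (lam : ℝ) (π : S → A → ℝ) (s : S) : ℝ :=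
  ∑' t : ℕ, M.γ ^ t *
    ∑ s', (M.transMatrix π ^ t) s s' *
      ∑ a, π s' a * (M.r s' a - lam * negEntropy (π s'))

/-- `J(π, lam) = V_lam^π(μ)`. -/
def objective (lam : ℝ) (π : S → A → ℝ) : ℝ :=
  ∑ s, M.μ s * M.value lam π s

/-- `π` maximizes `J(·, lam)` over all policies. -/
def IsOptimalPolicy (lam : ℝ) (π : S → A → ℝ) : Prop :=
  IsPolicy π ∧ ∀ π' : S → A → ℝ, IsPolicy π' → M.objective lam π' ≤ M.objective lam π

/-- The discounted state visitation distribution of `π` with `s_0 ∼ μ`. -/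
def visitation (π : S → A → ℝ) (s : S) : ℝ :=
  ∑ s₀, M.μ s₀ * ((1 - M.γ) * ∑' t : ℕ, M.γ ^ t * (M.transMatrix π ^ t) s₀ s)

/-- Gradient ascent with step size `η` on `θ ↦ J(π_θ, lam)`, started at `θ₀`; the parameter after
`t` iterations. -/
def pgParam (lam η : ℝ) (θ₀ : EuclideanSpace ℝ (S × A)) : ℕ → EuclideanSpace ℝ (S × A)
  | 0 => θ₀
  | t + 1 => pgParam lam η θ₀ t +
      η • gradient (fun θ : EuclideanSpace ℝ (S × A) => M.objective lam (softmaxPolicy θ))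
        (pgParam lam η θ₀ t)

/-- The learning rate `(1 - γ)³ / (8 + lam (4 + 8 log |A|))`. -/
def pgRate (lam : ℝ) : ℝ :=
  (1 - M.γ) ^ 3 / (8 + lam * (4 + 8 * Real.log (Fintype.card A)))

/-- The policy output by policy gradient started at `θ₀` after `t` iterations. -/
def pgPolicy (lam : ℝ) (θ₀ : EuclideanSpace ℝ (S × A)) (t : ℕ) : S → A → ℝ :=
  softmaxPolicy (M.pgParam lam (M.pgRate lam) θ₀ t)

/-- `c_lam = inf_{t ≥ 1} min_{s, a} π_t(a|s)²` along the policy gradient iterates. -/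
def pgMinProbSq (lam : ℝ) (θ₀ : EuclideanSpace ℝ (S × A)) : ℝ :=
  ⨅ t : ℕ, ⨅ s : S, ⨅ a : A, M.pgPolicy lam θ₀ (t + 1) s a ^ 2

/-- The rate `C_lam`, where `πstar` is the optimal policy. -/
def pgConst (lam : ℝ) (πstar : S → A → ℝ) (θ₀ : EuclideanSpace ℝ (S × A)) : ℝ :=
  M.pgMinProbSq lam θ₀ * (1 - M.γ) ^ 4 * (⨅ s, M.μ s) /
      ((8 / lam + 4 + 8 * Real.log (Fintype.card A)) * Fintype.card S) *
    ‖fun s => M.visitation πstar s / M.μ s‖⁻¹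

/-- `Time(lam) = (1 / C_lam) log (4 ‖1/μ‖_∞ / (1 - γ))`, in gradient iterations. -/
def pgTime (lam : ℝ) (πstar : S → A → ℝ) (θ₀ : EuclideanSpace ℝ (S × A)) : ℝ :=
  1 / M.pgConst lam πstar θ₀ * Real.log (4 * ‖fun s => 1 / M.μ s‖ / (1 - M.γ))

/-- An iterative algorithm, `alg x T` being the policy it outputs after `T` iterations from the
start `x` (so that `alg x 0` is the starting policy), satisfies Prop-I with error `εhat` in time
`time`: from every start, after any number `T ≥ time` of iterations, the output `π₁` satisfies
`V_lam^* - V_lam^π₁ ≤ (V_lam^*(μ) - V_lam^π₀(μ)) / 4 + εhat` in every state, where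
`V_lam^* = V_lam^πstar`. -/
def SatisfiesPropI {X : Type*} (lam : ℝ) (πstar : S → A → ℝ) (alg : X → ℕ → S → A → ℝ)
    (time : X → ℝ) (εhat : ℝ) : Prop :=
  ∀ (x : X) (T : ℕ), time x ≤ T → ∀ s : S,
    M.value lam πstar s - M.value lam (alg x T) s ≤
      1 / 4 * (M.objective lam πstar - M.objective lam (alg x 0)) + εhat

end FiniteMDP

end

/-!
The value difference of two policies is the discounted resolvent of the new chain applied to the
one-step regularized advantages over the old one (performance difference identity). Expanding it to
second order along the softmax parametrization shows that `J` is smooth enough for each gradient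
step with the given rate `η` to increase it by at least `3 / 4 * η * ‖∇J‖ ^ 2`. By Gibbs'
inequality and Hoeffding's lemma the regularized advantage of any policy over `π` in a state `s`
is at most `∑ a, A^π(s, a) ^ 2 / (2 λ)` with `A^π` the soft advantage of `π`; since the gradient has
the entries `d(s) π(a|s) A^π(s, a)`, with `d` the unnormalized discounted visitation measure of `π`,
this gives a Łojasiewicz inequality `‖∇J‖ ^ 2 ≥ const * (J* - J)` wherever `π` is bounded away from
`0`. Both together give linear convergence at a rate governed by `c_λ`.

That `c_λ > 0`: with `B` the bound on regularized values, a gradient entry is nonnegative wherever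
`log π(a|s) ≤ -B / λ`; elsewhere `θ(s, a)` is at most `B / λ` below the mean of its row, and one
step lowers it by a bounded amount. Each row of the gradient sums to `0`, so the row means never
change, and all parameters stay bounded below, hence also above.
-/

noncomputable section

open Matrix Filter Topology

section Analysis

theorem apply_le_norm {ι : Type*} [Fintype ι] (f : ι → ℝ) (i : ι) : f i ≤ ‖f‖ :=
  (le_abs_self _).trans (norm_le_pi_norm f i)

theorem abs_sub_le_of_abs_hasDerivAt_le {g g' : ℝ → ℝ} {c : ℝ}
    (hg : ∀ x, HasDerivAt g (g' x) x) (hc : ∀ x, |g' x| ≤ c) : |g 1 - g 0| ≤ c := by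
  simpa using convex_univ.norm_image_sub_le_of_norm_hasDerivWithin_le (𝕜 := ℝ)
    (fun x _ => (hg x).hasDerivWithinAt) (fun x _ => hc x) (Set.mem_univ 0) (Set.mem_univ 1)

/-- Adding `c / 2 * x ^ 2` makes `g` convex, and a convex function lies above its tangent at
`0`. -/
theorem add_sub_half_le_of_neg_le_deriv2 {g g' g'' : ℝ → ℝ} {c : ℝ}
    (hg : ∀ x, HasDerivAt g (g' x) x) (hg' : ∀ x, HasDerivAt g' (g'' x) x)
    (hc : ∀ x, -c ≤ g'' x) : g 0 + g' 0 - c / 2 ≤ g 1 := by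
  have hf (x : ℝ) : HasDerivAt (fun x => g x + c / 2 * x ^ 2) (g' x + c * x) x :=
    ((hg x).add ((hasDerivAt_pow 2 x).const_mul (c / 2))).congr_deriv (by ring)
  have hf' (x : ℝ) : HasDerivAt (fun x => g' x + c * x) (g'' x + c) x :=
    ((hg' x).add ((hasDerivAt_id x).const_mul c)).congr_deriv (by ring)
  have hconv : ConvexOn ℝ Set.univ fun x => g x + c / 2 * x ^ 2 :=
    convexOn_of_hasDerivWithinAt2_nonneg convex_univ
      (fun x _ => (hf x).continuousAt.continuousWithinAt)
      (fun x _ => (hf x).hasDerivWithinAt) (fun x _ => (hf' x).hasDerivWithinAt)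
      fun x _ => by linarith [hc x]
  have hslope := hconv.le_slope_of_hasDerivAt (Set.mem_univ 0) (Set.mem_univ 1) one_pos (hf 0)
  rw [slope_def_field] at hslope
  linarith

variable {E : Type*} [NormedAddCommGroup E] [InnerProductSpace ℝ E] {f : E → ℝ}

/-- The hypothesis at `y` in the direction `x - y` bounds `f y` from above, with the gradient at
`y` replaced by the one at `x` up to a small error by continuity. -/
theorem hasGradientAt_of_add_inner_sub_le [CompleteSpace E] {G : E → E} {b : ℝ} (hG : Continuous G)
    (h : ∀ x u, f x + inner ℝ (G x) u - b * ‖u‖ ^ 2 ≤ f (x + u)) (x : E) :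
    HasGradientAt f (G x) x := by
  rw [hasGradientAt_iff_isLittleO, Asymptotics.isLittleO_iff]
  intro c hc
  have hlim : Tendsto (fun y => |b| * ‖y - x‖ + ‖G y - G x‖) (𝓝 x) (𝓝 0) := by
    have : Continuous fun y => |b| * ‖y - x‖ + ‖G y - G x‖ := by fun_prop
    simpa only [sub_self, norm_zero, mul_zero, add_zero] using this.tendsto x
  filter_upwards [hlim.eventually (gt_mem_nhds hc)] with y hy
  have hlower := h x (y - x)
  have hupper := h y (x - y)
  rw [add_sub_cancel] at hlower hupper
  have hinner : inner ℝ (G y) (x - y) =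
      -inner ℝ (G y - G x) (y - x) - inner ℝ (G x) (y - x) := by
    rw [← neg_sub y x, inner_neg_right, inner_sub_left]
    ring
  have hcauchy := real_inner_le_norm (G y - G x) (y - x)
  have hsmall := mul_le_mul_of_nonneg_right hy.le (norm_nonneg (y - x))
  have hb := mul_le_mul_of_nonneg_right (le_abs_self b) (sq_nonneg ‖y - x‖)
  have hprod : 0 ≤ ‖G y - G x‖ * ‖y - x‖ := by positivity
  rw [norm_sub_rev x y] at hupper
  rw [Real.norm_eq_abs, abs_le]
  constructor <;> nlinarith

theorem add_norm_sq_le_apply_gradient_step {x G : E} {η : ℝ} (hη : 0 < η)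
    (h : ∀ u, f x + inner ℝ G u - ‖u‖ ^ 2 / (4 * η) ≤ f (x + u)) :
    f x + 3 / 4 * η * ‖G‖ ^ 2 ≤ f (x + η • G) := by
  refine le_trans (le_of_eq ?_) (h (η • G))
  rw [inner_smul_right, real_inner_self_eq_norm_sq, norm_smul, Real.norm_of_nonneg hη.le]
  field_simp
  ring

theorem le_exp_neg_mul_of_succ_le {u : ℕ → ℝ} {q : ℝ} (hu : ∀ n, 0 ≤ u n)
    (h : ∀ n, u (n + 1) ≤ (1 - q) * u n) (n : ℕ) : u n ≤ Real.exp (-q * n) * u 0 := by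
  have hstep (k : ℕ) : u (k + 1) ≤ Real.exp (-q) * u k :=
    (h k).trans (mul_le_mul_of_nonneg_right (Real.one_sub_le_exp_neg q) (hu k))
  rw [mul_comm (-q), Real.exp_nat_mul]
  exact le_geom (Real.exp_pos _).le n fun k _ => hstep k

end Analysis

/-- The resolvent `∑ t, γ ^ t • P ^ t` of a Markov chain with transition matrix `P`, summed
entrywise. -/
def discountedResolvent {n : Type*} [Fintype n] [DecidableEq n] (γ : ℝ) (P : Matrix n n ℝ) :
    Matrix n n ℝ :=
  of fun i j => ∑' t : ℕ, γ ^ t * (P ^ t) i j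

section Resolvent

variable {n : Type*} [Fintype n] [DecidableEq n] {γ : ℝ} {P : Matrix n n ℝ}

theorem norm_discount_mul_pow_apply_le (hγ : 0 ≤ γ) (hP : P ∈ rowStochastic ℝ n) (t : ℕ)
    (i j : n) : ‖γ ^ t * (P ^ t) i j‖ ≤ γ ^ t := by
  have hPt := pow_mem hP t
  rw [Real.norm_of_nonneg (mul_nonneg (pow_nonneg hγ t) (nonneg_of_mem_rowStochastic hPt))]
  exact mul_le_of_le_one_right (pow_nonneg hγ t) (le_one_of_mem_rowStochastic hPt)

theorem summable_discount_mul_pow_apply (hγ : γ ∈ Set.Ico 0 1) (hP : P ∈ rowStochastic ℝ n)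
    (i j : n) : Summable fun t : ℕ => γ ^ t * (P ^ t) i j :=
  (summable_geometric_of_lt_one hγ.1 hγ.2).of_norm_bounded fun t =>
    norm_discount_mul_pow_apply_le hγ.1 hP t i j

theorem continuousOn_discountedResolvent_apply (hγ : γ ∈ Set.Ico 0 1) (i j : n) :
    ContinuousOn (fun P => discountedResolvent γ P i j) {P | P ∈ rowStochastic ℝ n} :=
  continuousOn_tsum
    (fun t => (continuous_const.mul ((continuous_id.pow t).matrix_elem i j)).continuousOn)
    (summable_geometric_of_lt_one hγ.1 hγ.2)
    fun t _ hP => norm_discount_mul_pow_apply_le hγ.1 hP t i j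

theorem discountedResolvent_eq_one_add (hγ : γ ∈ Set.Ico 0 1) (hP : P ∈ rowStochastic ℝ n) :
    discountedResolvent γ P = 1 + γ • (P * discountedResolvent γ P) := by
  ext i j
  simp only [discountedResolvent, Matrix.add_apply, Matrix.smul_apply, mul_apply, of_apply,
    smul_eq_mul]
  rw [(summable_discount_mul_pow_apply hγ hP i j).tsum_eq_zero_add, pow_zero, pow_zero, one_mul]
  simp_rw [← tsum_mul_left]
  rw [← Summable.tsum_finsetSum fun k _ =>
    (summable_discount_mul_pow_apply hγ hP k j).mul_left _, ← tsum_mul_left]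
  congr 1
  refine tsum_congr fun t => ?_
  rw [pow_succ' P, mul_apply, Finset.mul_sum, Finset.mul_sum]
  exact Finset.sum_congr rfl fun k _ => by ring

theorem discountedResolvent_mul_one_sub_smul (hγ : γ ∈ Set.Ico 0 1)
    (hP : P ∈ rowStochastic ℝ n) : discountedResolvent γ P * (1 - γ • P) = 1 := by
  refine mul_eq_one_comm.1 ?_
  rw [sub_mul, one_mul, smul_mul_assoc, sub_eq_iff_eq_add]
  exact discountedResolvent_eq_one_add hγ hP

theorem eq_discountedResolvent_mulVec (hγ : γ ∈ Set.Ico 0 1) (hP : P ∈ rowStochastic ℝ n)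
    {x w : n → ℝ} (h : x = w + γ • (P *ᵥ x)) : x = discountedResolvent γ P *ᵥ w := by
  have hw : w = (1 - γ • P) *ᵥ x := by
    rw [sub_mulVec, one_mulVec, smul_mulVec]
    exact eq_sub_of_add_eq h.symm
  rw [hw, mulVec_mulVec, discountedResolvent_mul_one_sub_smul hγ hP, one_mulVec]

theorem discountedResolvent_mulVec_eq_add (hγ : γ ∈ Set.Ico 0 1) (hP : P ∈ rowStochastic ℝ n)
    (w : n → ℝ) : discountedResolvent γ P *ᵥ w =
      w + γ • (P *ᵥ (discountedResolvent γ P *ᵥ w)) := by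
  conv_lhs => rw [discountedResolvent_eq_one_add hγ hP]
  rw [add_mulVec, one_mulVec, smul_mulVec, mulVec_mulVec]

theorem discountedResolvent_nonneg (hγ : 0 ≤ γ) (hP : P ∈ rowStochastic ℝ n) (i j : n) :
    0 ≤ discountedResolvent γ P i j :=
  tsum_nonneg fun t => mul_nonneg (pow_nonneg hγ t) (nonneg_of_mem_rowStochastic (pow_mem hP t))

theorem discountedResolvent_mulVec_nonneg (hγ : 0 ≤ γ) (hP : P ∈ rowStochastic ℝ n)
    {w : n → ℝ} (hw : 0 ≤ w) : 0 ≤ discountedResolvent γ P *ᵥ w := fun i =>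
  Finset.sum_nonneg fun j _ => mul_nonneg (discountedResolvent_nonneg hγ hP i j) (hw j)

theorem le_discountedResolvent_mulVec (hγ : γ ∈ Set.Ico 0 1) (hP : P ∈ rowStochastic ℝ n)
    {w : n → ℝ} (hw : 0 ≤ w) : w ≤ discountedResolvent γ P *ᵥ w := by
  rw [discountedResolvent_mulVec_eq_add hγ hP]
  exact le_add_of_nonneg_right (smul_nonneg hγ.1 (nonneg_mulVec_of_mem_rowStochastic hP
    (discountedResolvent_mulVec_nonneg hγ.1 hP hw)))

theorem one_le_discountedResolvent_diag (hγ : γ ∈ Set.Ico 0 1) (hP : P ∈ rowStochastic ℝ n)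
    (i : n) : 1 ≤ discountedResolvent γ P i i := by
  simpa only [Pi.single_eq_same, mulVec_single_one, col_apply] using
    le_discountedResolvent_mulVec hγ hP (Pi.single_nonneg.2 (zero_le_one' ℝ) : 0 ≤ Pi.single i 1) i

theorem discountedResolvent_mulVec_one (hγ : γ ∈ Set.Ico 0 1) (hP : P ∈ rowStochastic ℝ n) :
    discountedResolvent γ P *ᵥ 1 = fun _ => 1 / (1 - γ) := by
  have hconst : (fun _ : n => 1 / (1 - γ)) = (1 / (1 - γ)) • (1 : n → ℝ) := by
    ext; simp
  refine (eq_discountedResolvent_mulVec hγ hP ?_).symm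
  rw [hconst, mulVec_smul, one_vecMul_of_mem_rowStochastic hP]
  ext i
  have hx := (sub_pos.2 hγ.2).ne'
  simp only [Pi.add_apply, Pi.smul_apply, Pi.one_apply, smul_eq_mul]
  field_simp
  ring

theorem sum_discountedResolvent (hγ : γ ∈ Set.Ico 0 1) (hP : P ∈ rowStochastic ℝ n) (i : n) :
    ∑ j, discountedResolvent γ P i j = 1 / (1 - γ) := by
  simpa only [mulVec, dotProduct_one] using congrFun (discountedResolvent_mulVec_one hγ hP) i

theorem discountedResolvent_mulVec_le (hγ : γ ∈ Set.Ico 0 1) (hP : P ∈ rowStochastic ℝ n)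
    {w : n → ℝ} {c : ℝ} (hw : ∀ i, w i ≤ c) (i : n) :
    (discountedResolvent γ P *ᵥ w) i ≤ c / (1 - γ) :=
  calc (discountedResolvent γ P *ᵥ w) i ≤ ∑ j, discountedResolvent γ P i j * c :=
        Finset.sum_le_sum fun j _ =>
          mul_le_mul_of_nonneg_left (hw j) (discountedResolvent_nonneg hγ.1 hP i j)
    _ = c / (1 - γ) := by
        rw [← Finset.sum_mul, sum_discountedResolvent hγ hP, one_div_mul_eq_div]

theorem abs_discountedResolvent_mulVec_le (hγ : γ ∈ Set.Ico 0 1) (hP : P ∈ rowStochastic ℝ n)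
    {w : n → ℝ} {c : ℝ} (hw : ∀ i, |w i| ≤ c) (i : n) :
    |(discountedResolvent γ P *ᵥ w) i| ≤ c / (1 - γ) := by
  refine abs_le'.2
    ⟨discountedResolvent_mulVec_le hγ hP (fun i => (le_abs_self _).trans (hw i)) i, ?_⟩
  rw [← Pi.neg_apply, ← mulVec_neg]
  exact discountedResolvent_mulVec_le hγ hP (fun i => (neg_le_abs _).trans (hw i)) i

end Resolvent

section Distribution

variable {A : Type*} [Fintype A] {p u : A → ℝ} {c : ℝ}

theorem nonempty_of_mem_stdSimplex (hp : p ∈ stdSimplex ℝ A) : Nonempty A := by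
  by_contra hA
  rw [not_nonempty_iff] at hA
  simpa using hp.2

theorem dotProduct_const_of_mem_stdSimplex (hp : p ∈ stdSimplex ℝ A) (c : ℝ) :
    p ⬝ᵥ (fun _ => c) = c := by
  rw [dotProduct, ← Finset.sum_mul, hp.2, one_mul]

theorem dotProduct_le_of_mem_stdSimplex (hp : p ∈ stdSimplex ℝ A) (hu : ∀ a, u a ≤ c) :
    p ⬝ᵥ u ≤ c :=
  (dotProduct_le_dotProduct_of_nonneg_left hu hp.1).trans_eq
    (dotProduct_const_of_mem_stdSimplex hp c)

theorem abs_dotProduct_le_of_mem_stdSimplex (hp : p ∈ stdSimplex ℝ A) (hu : ∀ a, |u a| ≤ c) :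
    |p ⬝ᵥ u| ≤ c := by
  refine abs_le'.2
    ⟨dotProduct_le_of_mem_stdSimplex hp fun a => (le_abs_self _).trans (hu a), ?_⟩
  rw [← dotProduct_neg]
  exact dotProduct_le_of_mem_stdSimplex hp fun a => (neg_le_abs _).trans (hu a)

theorem dotProduct_sub_const_of_mem_stdSimplex (hp : p ∈ stdSimplex ℝ A) (u : A → ℝ) (c : ℝ) :
    p ⬝ᵥ (fun a => u a - c) = p ⬝ᵥ u - c := by
  rw [← dotProduct_const_of_mem_stdSimplex hp c, ← dotProduct_sub,
    dotProduct_const_of_mem_stdSimplex hp c]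
  rfl

theorem dotProduct_sub_mul_comm (p u v : A → ℝ) :
    p ⬝ᵥ (fun a => (u a - p ⬝ᵥ u) * v a) = p ⬝ᵥ fun a => (v a - p ⬝ᵥ v) * u a := by
  have hcov (x y : A → ℝ) : p ⬝ᵥ (fun a => (x a - p ⬝ᵥ x) * y a) =
      p ⬝ᵥ (fun a => x a * y a) - p ⬝ᵥ x * p ⬝ᵥ y := by
    simp only [dotProduct, sub_mul, mul_sub, Finset.sum_sub_distrib, mul_left_comm (p _),
      ← Finset.mul_sum]
  rw [hcov, hcov, mul_comm (p ⬝ᵥ u)]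
  simp only [mul_comm (u _)]

theorem abs_sub_le_sqrt_two_mul_sum_sq (u : A → ℝ) (a b : A) :
    |u a - u b| ≤ √(2 * ∑ i, u i ^ 2) := by
  classical
  refine Real.abs_le_sqrt ?_
  rcases eq_or_ne a b with rfl | hab
  · rw [sub_self, zero_pow two_ne_zero]
    positivity
  · have hpair : u a ^ 2 + u b ^ 2 ≤ ∑ i, u i ^ 2 := by
      rw [← Finset.sum_pair (f := fun i => u i ^ 2) hab]
      exact Finset.sum_le_sum_of_subset_of_nonneg (Finset.subset_univ _)
        fun i _ _ => sq_nonneg _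
    linarith [add_sq_le (a := u a) (b := -u b), neg_sq (u b)]

theorem abs_sub_dotProduct_le_of_mem_stdSimplex (hp : p ∈ stdSimplex ℝ A) (u : A → ℝ) (a : A) :
    |u a - p ⬝ᵥ u| ≤ √(2 * ∑ i, u i ^ 2) := by
  rw [abs_sub_comm, ← dotProduct_sub_const_of_mem_stdSimplex hp]
  exact abs_dotProduct_le_of_mem_stdSimplex hp fun b => abs_sub_le_sqrt_two_mul_sum_sq u b a

theorem dotProduct_sub_sq_of_mem_stdSimplex (hp : p ∈ stdSimplex ℝ A) (u : A → ℝ) :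
    p ⬝ᵥ (fun a => (u a - p ⬝ᵥ u) ^ 2) = p ⬝ᵥ u ^ 2 - (p ⬝ᵥ u) ^ 2 := by
  have hexpand : (fun a => (u a - p ⬝ᵥ u) ^ 2) =
      fun a => (u ^ 2 - (2 * p ⬝ᵥ u) • u) a - -(p ⬝ᵥ u) ^ 2 := by
    ext a
    simp only [Pi.sub_apply, Pi.pow_apply, Pi.smul_apply, smul_eq_mul]
    ring
  rw [hexpand, dotProduct_sub_const_of_mem_stdSimplex hp, dotProduct_sub, dotProduct_smul,
    smul_eq_mul]
  ring

theorem dotProduct_sub_sq_le_of_mem_stdSimplex (hp : p ∈ stdSimplex ℝ A) (u : A → ℝ) :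
    p ⬝ᵥ (fun a => (u a - p ⬝ᵥ u) ^ 2) ≤ ∑ a, u a ^ 2 := by
  rw [dotProduct_sub_sq_of_mem_stdSimplex hp]
  exact (sub_le_self _ (sq_nonneg _)).trans (Finset.sum_le_sum fun a _ =>
    mul_le_of_le_one_left (sq_nonneg _) (mem_Icc_of_mem_stdSimplex hp a).2)

theorem dotProduct_exp_le_exp_half_sq (hp : p ∈ stdSimplex ℝ A) (hmean : p ⬝ᵥ u = 0)
    (hu : ∀ a, |u a| ≤ c) : p ⬝ᵥ (fun a => Real.exp (u a)) ≤ Real.exp (c ^ 2 / 2) := by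
  have hchord (a : A) :
      Real.exp (u a) ≤ (u a / c) * Real.sinh c - -Real.cosh c := by
    rcases ((abs_nonneg _).trans (hu a)).eq_or_lt with rfl | hc
    · simp [abs_nonpos_iff.1 (hu a)]
    · have ht : |u a / c| ≤ 1 := by
        rw [abs_div, abs_of_pos hc]
        exact div_le_one_of_le₀ (hu a) hc.le
      have := Real.exp_mul_le_cosh_add_mul_sinh ht c
      rw [div_mul_cancel₀ _ hc.ne'] at this
      linarith
  have hmean' : p ⬝ᵥ (fun a => u a / c * Real.sinh c) = 0 := by
    have : (fun a => u a / c * Real.sinh c) = (Real.sinh c / c) • u := by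
      ext a
      rw [Pi.smul_apply, smul_eq_mul]
      ring
    rw [this, dotProduct_smul, hmean, smul_zero]
  calc p ⬝ᵥ (fun a => Real.exp (u a))
      ≤ p ⬝ᵥ (fun a => u a / c * Real.sinh c - -Real.cosh c) :=
        dotProduct_le_dotProduct_of_nonneg_left hchord hp.1
    _ = Real.cosh c := by
        rw [dotProduct_sub_const_of_mem_stdSimplex hp, hmean', zero_sub, neg_neg]
    _ ≤ Real.exp (c ^ 2 / 2) := Real.cosh_le_exp_half_sq c

theorem sum_mul_log_sub_log_le_log_sum (hp : p ∈ stdSimplex ℝ A) {w : A → ℝ}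
    (hw : ∀ a, 0 < w a) :
    ∑ a, p a * (Real.log (w a) - Real.log (p a)) ≤ Real.log (∑ a, w a) := by
  have := nonempty_of_mem_stdSimplex hp
  have hW : 0 < ∑ a, w a := Finset.sum_pos (fun a _ => hw a) Finset.univ_nonempty
  have hterm (a : A) : p a * (Real.log (w a) - Real.log (p a)) ≤
      p a * Real.log (∑ b, w b) + (w a / ∑ b, w b - p a) := by
    rcases (hp.1 a).eq_or_lt with hpa | hpa
    · rw [← hpa, zero_mul, zero_mul, zero_add, sub_zero]
      exact (div_pos (hw a) hW).le
    · have hlog := Real.log_le_sub_one_of_pos (div_pos (div_pos (hw a) hW) hpa)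
      rw [Real.log_div (div_pos (hw a) hW).ne' hpa.ne', Real.log_div (hw a).ne' hW.ne'] at hlog
      have hmul := mul_le_mul_of_nonneg_left hlog hpa.le
      rw [mul_sub_one, mul_div_cancel₀ _ hpa.ne'] at hmul
      linarith
  refine (Finset.sum_le_sum fun a _ => hterm a).trans_eq ?_
  rw [Finset.sum_add_distrib, Finset.sum_sub_distrib, ← Finset.sum_mul, ← Finset.sum_div, hp.2,
    div_self hW.ne', sub_self, add_zero, one_mul]

theorem negEntropy_nonpos (hp : p ∈ stdSimplex ℝ A) : negEntropy p ≤ 0 :=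
  Finset.sum_nonpos fun a _ => mul_nonpos_of_nonneg_of_nonpos (hp.1 a)
    (Real.log_nonpos (hp.1 a) (mem_Icc_of_mem_stdSimplex hp a).2)

theorem neg_negEntropy_le_log_card (hp : p ∈ stdSimplex ℝ A) :
    -negEntropy p ≤ Real.log (Fintype.card A) := by
  simpa [negEntropy] using sum_mul_log_sub_log_le_log_sum hp (w := 1) fun _ => one_pos

theorem continuous_negEntropy : Continuous (negEntropy : (A → ℝ) → ℝ) :=
  continuous_finsetSum _ fun a _ => Real.continuous_mul_log.comp (continuous_apply a)

end Distribution

/-- The objective `∑ a, p a Q(a) - lam Ω(p)` of the entropy-regularized bandit with gains `Q`. -/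
def entropicGain {A : Type*} [Fintype A] (lam : ℝ) (Q p : A → ℝ) : ℝ :=
  p ⬝ᵥ Q - lam * negEntropy p

/-- The advantage of the action `a` over the distribution `p` in the entropy-regularized bandit
with gains `Q`; playing `a` is charged the regularization cost `lam log p(a)`. -/
def entropicAdvantage {A : Type*} [Fintype A] (lam : ℝ) (Q p : A → ℝ) (a : A) : ℝ :=
  Q a - lam * Real.log (p a) - entropicGain lam Q p

section Bandit

variable {A : Type*} [Fintype A] {lam b : ℝ} {Q p : A → ℝ}

theorem entropicGain_eq_dotProduct (lam : ℝ) (Q p : A → ℝ) :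
    entropicGain lam Q p = p ⬝ᵥ fun a => Q a - lam * Real.log (p a) := by
  simp only [entropicGain, negEntropy, dotProduct, mul_sub, Finset.sum_sub_distrib,
    Finset.mul_sum, mul_left_comm]

theorem entropicGain_add (lam : ℝ) (Q Q' p : A → ℝ) :
    entropicGain lam (Q + Q') p = entropicGain lam Q p + p ⬝ᵥ Q' := by
  rw [entropicGain, entropicGain, dotProduct_add, add_sub_right_comm]

theorem entropicGain_nonneg (hlam : 0 ≤ lam) (hQ : 0 ≤ Q) (hp : p ∈ stdSimplex ℝ A) :
    0 ≤ entropicGain lam Q p :=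
  sub_nonneg.2 ((mul_nonpos_of_nonneg_of_nonpos hlam (negEntropy_nonpos hp)).trans
    (dotProduct_nonneg_of_nonneg hp.1 hQ))

theorem entropicGain_le (hlam : 0 ≤ lam) (hQ : ∀ a, Q a ≤ b) (hp : p ∈ stdSimplex ℝ A) :
    entropicGain lam Q p ≤ b + lam * Real.log (Fintype.card A) := by
  have hmean := dotProduct_le_of_mem_stdSimplex hp hQ
  have hentropy := mul_le_mul_of_nonneg_left (neg_negEntropy_le_log_card hp) hlam
  rw [entropicGain]
  linarith

theorem sub_mul_log_nonneg (hlam : 0 ≤ lam) (hQ : 0 ≤ Q) (hp : p ∈ stdSimplex ℝ A) (a : A) :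
    0 ≤ Q a - lam * Real.log (p a) :=
  sub_nonneg.2 ((mul_nonpos_of_nonneg_of_nonpos hlam
    (Real.log_nonpos (hp.1 a) (mem_Icc_of_mem_stdSimplex hp a).2)).trans (hQ a))

theorem neg_le_entropicAdvantage (hlam : 0 ≤ lam) (hQ₀ : 0 ≤ Q) (hQ : ∀ a, Q a ≤ b)
    (hp : p ∈ stdSimplex ℝ A) (a : A) :
    -(b + lam * Real.log (Fintype.card A)) ≤ entropicAdvantage lam Q p a := by
  have hgain := sub_mul_log_nonneg hlam hQ₀ hp a
  have hmean := entropicGain_le hlam hQ hp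
  rw [entropicAdvantage]
  linarith

theorem dotProduct_entropicAdvantage (lam : ℝ) (Q : A → ℝ) {p p' : A → ℝ}
    (hp' : p' ∈ stdSimplex ℝ A) :
    p' ⬝ᵥ entropicAdvantage lam Q p =
      p' ⬝ᵥ (fun a => Q a - lam * Real.log (p a)) - entropicGain lam Q p :=
  dotProduct_sub_const_of_mem_stdSimplex hp' _ _

theorem dotProduct_entropicAdvantage_self (lam : ℝ) (Q : A → ℝ) (hp : p ∈ stdSimplex ℝ A) :
    p ⬝ᵥ entropicAdvantage lam Q p = 0 := by
  rw [dotProduct_entropicAdvantage lam Q hp, ← entropicGain_eq_dotProduct, sub_self]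

/-- By Gibbs' inequality with the weights `q(a) exp(A(a) / lam)`, where `A` is the advantage over
`q`, the gap is at most `lam` times the cumulant generating function of `A / lam` under `q`. -/
theorem entropicGain_sub_le_mul_log (hlam : 0 < lam) (Q : A → ℝ) {q : A → ℝ}
    (hq : ∀ a, 0 < q a) (hp : p ∈ stdSimplex ℝ A) :
    entropicGain lam Q p - entropicGain lam Q q ≤
      lam * Real.log (q ⬝ᵥ fun a => Real.exp (entropicAdvantage lam Q q a / lam)) := by
  have hgibbs := sum_mul_log_sub_log_le_log_sum hp
    fun a => mul_pos (hq a) (Real.exp_pos (entropicAdvantage lam Q q a / lam))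
  refine le_of_eq_of_le ?_ (mul_le_mul_of_nonneg_left hgibbs hlam.le)
  rw [entropicGain_eq_dotProduct lam Q p, ← dotProduct_sub_const_of_mem_stdSimplex hp,
    Finset.mul_sum]
  refine Finset.sum_congr rfl fun a _ => ?_
  rw [Real.log_mul (hq a).ne' (Real.exp_pos _).ne', Real.log_exp, entropicAdvantage]
  field_simp
  ring

theorem entropicGain_sub_le_sum_entropicAdvantage_sq (hlam : 0 < lam) (Q : A → ℝ) {q : A → ℝ}
    (hq : q ∈ stdSimplex ℝ A) (hq₀ : ∀ a, 0 < q a) (hp : p ∈ stdSimplex ℝ A) :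
    entropicGain lam Q p - entropicGain lam Q q ≤
      (∑ a, entropicAdvantage lam Q q a ^ 2) / (2 * lam) := by
  set K := ∑ a, entropicAdvantage lam Q q a ^ 2
  have hK : 0 ≤ K := Finset.sum_nonneg fun a _ => sq_nonneg _
  have hmean : q ⬝ᵥ (fun a => entropicAdvantage lam Q q a / lam) = 0 := by
    have := dotProduct_entropicAdvantage_self lam Q hq
    simp only [dotProduct] at this
    simp only [dotProduct, mul_div_assoc', ← Finset.sum_div, this, zero_div]
  have hbound (a : A) : |entropicAdvantage lam Q q a / lam| ≤ √K / lam := by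
    rw [abs_div, abs_of_pos hlam]
    refine div_le_div_of_nonneg_right (Real.abs_le_sqrt ?_) hlam.le
    exact Finset.single_le_sum (f := fun a => entropicAdvantage lam Q q a ^ 2)
      (fun i _ => sq_nonneg _) (Finset.mem_univ a)
  have hcgf : Real.log (q ⬝ᵥ fun a => Real.exp (entropicAdvantage lam Q q a / lam)) ≤
      (√K / lam) ^ 2 / 2 := by
    have := nonempty_of_mem_stdSimplex hq
    have hpos : 0 < q ⬝ᵥ fun a => Real.exp (entropicAdvantage lam Q q a / lam) :=
      Finset.sum_pos (fun a _ => mul_pos (hq₀ a) (Real.exp_pos _)) Finset.univ_nonempty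
    exact (Real.log_le_iff_le_exp hpos).2 (dotProduct_exp_le_exp_half_sq hq hmean hbound)
  refine (entropicGain_sub_le_mul_log hlam Q hq₀ hp).trans
    ((mul_le_mul_of_nonneg_left hcgf hlam.le).trans_eq ?_)
  rw [div_pow, Real.sq_sqrt hK]
  field_simp

end Bandit

/-- The softmax (Gibbs) distribution of the logits `z`. -/
def softmax {A : Type*} [Fintype A] (z : A → ℝ) (a : A) : ℝ :=
  Real.exp (z a) / ∑ b, Real.exp (z b)

/-- The derivative of the entropy-regularized bandit objective at `softmax z` when the logits `z`
move in the direction `u`. -/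
def entropicSlope {A : Type*} [Fintype A] (lam : ℝ) (Q z u : A → ℝ) : ℝ :=
  softmax z ⬝ᵥ fun a => entropicAdvantage lam Q (softmax z) a * u a

theorem entropicSlope_eq_covariance {A : Type*} [Fintype A] (lam : ℝ) (Q z u : A → ℝ) :
    entropicSlope lam Q z u =
      softmax z ⬝ᵥ fun a =>
        (u a - softmax z ⬝ᵥ u) * (Q a - lam * Real.log (softmax z a)) := by
  rw [dotProduct_sub_mul_comm, ← entropicGain_eq_dotProduct]
  rfl

section Softmax

variable {A : Type*} [Fintype A] [Nonempty A]

theorem sum_exp_pos (z : A → ℝ) : 0 < ∑ a, Real.exp (z a) :=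
  Finset.sum_pos (fun _ _ => Real.exp_pos _) Finset.univ_nonempty

theorem softmax_pos (z : A → ℝ) (a : A) : 0 < softmax z a :=
  div_pos (Real.exp_pos _) (sum_exp_pos z)

theorem softmax_mem_stdSimplex (z : A → ℝ) : softmax z ∈ stdSimplex ℝ A := by
  refine ⟨fun a => (softmax_pos z a).le, ?_⟩
  simp only [softmax, ← Finset.sum_div]
  exact div_self (sum_exp_pos z).ne'

theorem log_softmax (z : A → ℝ) (a : A) :
    Real.log (softmax z a) = z a - Real.log (∑ b, Real.exp (z b)) := by
  rw [softmax, Real.log_div (Real.exp_pos _).ne' (sum_exp_pos z).ne', Real.log_exp]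

section SoftmaxLine

variable (z u : A → ℝ)

theorem hasDerivAt_log_softmax_line (a : A) (α : ℝ) :
    HasDerivAt (fun α : ℝ => Real.log (softmax (z + α • u) a))
      (u a - softmax (z + α • u) ⬝ᵥ u) α := by
  have hlogit (b : A) : HasDerivAt (fun α : ℝ => (z + α • u) b) (u b) α := by
    simpa using ((hasDerivAt_id α).mul_const (u b)).const_add (z b)
  have hlogsum := (HasDerivAt.fun_sum fun b (_ : b ∈ Finset.univ) => (hlogit b).exp).log
    (sum_exp_pos _).ne'
  simp only [log_softmax]
  refine ((hlogit a).sub hlogsum).congr_deriv ?_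
  simp only [softmax, dotProduct, Finset.sum_div, div_mul_eq_mul_div]

theorem hasDerivAt_softmax_line (a : A) (α : ℝ) :
    HasDerivAt (fun α : ℝ => softmax (z + α • u) a)
      (softmax (z + α • u) a * (u a - softmax (z + α • u) ⬝ᵥ u)) α := by
  simpa only [Real.exp_log (softmax_pos _ a)] using (hasDerivAt_log_softmax_line z u a α).exp

theorem hasDerivAt_softmax_line_dotProduct {w : ℝ → A → ℝ} {w' : A → ℝ} {α : ℝ}
    (hw : ∀ a, HasDerivAt (fun α => w α a) (w' a) α) :
    HasDerivAt (fun α : ℝ => softmax (z + α • u) ⬝ᵥ w α)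
      (softmax (z + α • u) ⬝ᵥ
        fun a => (u a - softmax (z + α • u) ⬝ᵥ u) * w α a + w' a) α := by
  refine (HasDerivAt.fun_sum fun a (_ : a ∈ Finset.univ) =>
    (hasDerivAt_softmax_line z u a α).fun_mul (hw a)).congr_deriv ?_
  exact Finset.sum_congr rfl fun a _ => by ring

end SoftmaxLine

section EntropicGainLine

variable (lam : ℝ) (Q z u : A → ℝ) (α : ℝ)

theorem hasDerivAt_entropicGain_line :
    HasDerivAt (fun α : ℝ => entropicGain lam Q (softmax (z + α • u)))
      (entropicSlope lam Q (z + α • u) u) α := by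
  simp only [entropicGain_eq_dotProduct]
  refine (hasDerivAt_softmax_line_dotProduct z u fun a =>
    ((hasDerivAt_log_softmax_line z u a α).const_mul lam).const_sub (Q a)).congr_deriv ?_
  have hmean : softmax (z + α • u) ⬝ᵥ (fun a => -(lam * (u a - softmax (z + α • u) ⬝ᵥ u))) = 0 := by
    have hp := softmax_mem_stdSimplex (z + α • u)
    have hsmul : (fun a => -(lam * (u a - softmax (z + α • u) ⬝ᵥ u))) =
        (-lam) • fun a => u a - softmax (z + α • u) ⬝ᵥ u := by
      ext a
      rw [Pi.smul_apply, smul_eq_mul, neg_mul]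
    rw [hsmul, dotProduct_smul, dotProduct_sub_const_of_mem_stdSimplex hp, sub_self, smul_zero]
  rw [entropicSlope_eq_covariance]
  exact (dotProduct_add _ _ _).trans (by rw [hmean, add_zero])

theorem hasDerivAt_entropicSlope_line :
    HasDerivAt (fun α : ℝ => entropicSlope lam Q (z + α • u) u)
      (softmax (z + α • u) ⬝ᵥ fun a => (u a - softmax (z + α • u) ⬝ᵥ u) ^ 2 *
        (entropicAdvantage lam Q (softmax (z + α • u)) a - lam)) α := by
  refine (hasDerivAt_softmax_line_dotProduct z u fun a =>
    ((((hasDerivAt_log_softmax_line z u a α).const_mul lam).const_sub (Q a)).sub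
      (hasDerivAt_entropicGain_line lam Q z u α)).mul_const (u a)).congr_deriv ?_
  change softmax (z + α • u) ⬝ᵥ (fun a => (u a - softmax (z + α • u) ⬝ᵥ u) *
    (entropicAdvantage lam Q (softmax (z + α • u)) a * u a) + _) = _
  have hp := softmax_mem_stdSimplex (z + α • u)
  generalize hσ : entropicSlope lam Q (z + α • u) u = σ
  rw [entropicSlope] at hσ
  generalize softmax (z + α • u) = p at hp hσ ⊢
  have hA := dotProduct_entropicAdvantage_self lam Q hp
  have hu := dotProduct_sub_const_of_mem_stdSimplex hp u (p ⬝ᵥ u)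
  rw [sub_self] at hu
  generalize hm : p ⬝ᵥ u = m at hu ⊢
  have hterm (a : A) : p a * ((u a - m) * (entropicAdvantage lam Q p a * u a) +
      (-(lam * (u a - m)) - σ) * u a) =
      p a * ((u a - m) ^ 2 * (entropicAdvantage lam Q p a - lam)) +
        m * (p a * (entropicAdvantage lam Q p a * u a)) -
        m ^ 2 * (p a * entropicAdvantage lam Q p a) - lam * m * (p a * (u a - m)) -
        σ * (p a * u a) := by ring
  simp only [dotProduct] at hA hu hσ hm ⊢
  simp only [hterm, Finset.sum_add_distrib, Finset.sum_sub_distrib, ← Finset.mul_sum, hA, hu, hσ,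
    hm]
  ring

end EntropicGainLine

section Bounds

variable {lam b : ℝ} {Q : A → ℝ}

theorem abs_entropicSlope_le (hlam : 0 ≤ lam) (hQ₀ : 0 ≤ Q) (hQ : ∀ a, Q a ≤ b) (z u : A → ℝ) :
    |entropicSlope lam Q z u| ≤
      √(2 * ∑ a, u a ^ 2) * (b + lam * Real.log (Fintype.card A)) := by
  have hz := softmax_mem_stdSimplex z
  have hgain := sub_mul_log_nonneg hlam hQ₀ hz
  rw [entropicSlope_eq_covariance]
  calc |softmax z ⬝ᵥ fun a => (u a - softmax z ⬝ᵥ u) * (Q a - lam * Real.log (softmax z a))|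
      ≤ ∑ a, |softmax z a * ((u a - softmax z ⬝ᵥ u) * (Q a - lam * Real.log (softmax z a)))| :=
        Finset.abs_sum_le_sum_abs _ _
    _ ≤ ∑ a, √(2 * ∑ a, u a ^ 2) * (softmax z a * (Q a - lam * Real.log (softmax z a))) := by
        refine Finset.sum_le_sum fun a _ => ?_
        have h := mul_nonneg (hz.1 a) (hgain a)
        rw [mul_left_comm, abs_mul, abs_of_nonneg h]
        exact mul_le_mul_of_nonneg_right (abs_sub_dotProduct_le_of_mem_stdSimplex hz u a) h
    _ = √(2 * ∑ a, u a ^ 2) * entropicGain lam Q (softmax z) := by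
        rw [← Finset.mul_sum, entropicGain_eq_dotProduct, dotProduct]
    _ ≤ _ := mul_le_mul_of_nonneg_left (entropicGain_le hlam hQ hz) (Real.sqrt_nonneg _)

theorem abs_entropicGain_softmax_add_sub_le (hlam : 0 ≤ lam) (hQ₀ : 0 ≤ Q) (hQ : ∀ a, Q a ≤ b)
    (z u : A → ℝ) :
    |entropicGain lam Q (softmax (z + u)) - entropicGain lam Q (softmax z)| ≤
      √(2 * ∑ a, u a ^ 2) * (b + lam * Real.log (Fintype.card A)) := by
  simpa only [one_smul, zero_smul, add_zero] using
    abs_sub_le_of_abs_hasDerivAt_le (fun x => hasDerivAt_entropicGain_line lam Q z u x)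
      fun x => abs_entropicSlope_le hlam hQ₀ hQ (z + x • u) u

theorem entropicGain_softmax_add_ge (hlam : 0 ≤ lam) (hQ₀ : 0 ≤ Q) (hQ : ∀ a, Q a ≤ b)
    (z u : A → ℝ) :
    entropicGain lam Q (softmax z) + entropicSlope lam Q z u -
        (b + lam * Real.log (Fintype.card A) + lam) * (∑ a, u a ^ 2) / 2 ≤
      entropicGain lam Q (softmax (z + u)) := by
  set B := b + lam * Real.log (Fintype.card A)
  suffices hcurv : ∀ x : ℝ, -((B + lam) * ∑ a, u a ^ 2) ≤
      softmax (z + x • u) ⬝ᵥ fun a => (u a - softmax (z + x • u) ⬝ᵥ u) ^ 2 *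
        (entropicAdvantage lam Q (softmax (z + x • u)) a - lam) by
    simpa only [one_smul, zero_smul, add_zero] using add_sub_half_le_of_neg_le_deriv2
      (fun x => hasDerivAt_entropicGain_line lam Q z u x)
      (fun x => hasDerivAt_entropicSlope_line lam Q z u x) hcurv
  intro x
  have hp := softmax_mem_stdSimplex (z + x • u)
  generalize softmax (z + x • u) = p at hp ⊢
  have hB : 0 ≤ B := (entropicGain_nonneg hlam hQ₀ hp).trans (entropicGain_le hlam hQ hp)
  calc -((B + lam) * ∑ a, u a ^ 2)
      ≤ -((B + lam) * p ⬝ᵥ fun a => (u a - p ⬝ᵥ u) ^ 2) :=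
        neg_le_neg (mul_le_mul_of_nonneg_left (dotProduct_sub_sq_le_of_mem_stdSimplex hp u)
          (add_nonneg hB hlam))
    _ = p ⬝ᵥ fun a => (u a - p ⬝ᵥ u) ^ 2 * (-B - lam) := by
        simp only [dotProduct, ← mul_assoc, ← Finset.sum_mul]
        ring
    _ ≤ _ := dotProduct_le_dotProduct_of_nonneg_left (fun a => mul_le_mul_of_nonneg_left
        (sub_le_sub_right (neg_le_entropicAdvantage hlam hQ₀ hQ hp a) lam) (sq_nonneg _)) hp.1

theorem abs_softmax_add_sub_dotProduct_le {c : A → ℝ} {k : ℝ} (hc : ∀ a, |c a| ≤ k)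
    (z u : A → ℝ) :
    |(softmax (z + u) - softmax z) ⬝ᵥ c| ≤ √(2 * ∑ a, u a ^ 2) * k := by
  have hderiv (x : ℝ) : HasDerivAt (fun x : ℝ => softmax (z + x • u) ⬝ᵥ c)
      (softmax (z + x • u) ⬝ᵥ fun a => (u a - softmax (z + x • u) ⬝ᵥ u) * c a) x := by
    simpa only [Pi.zero_apply, add_zero] using hasDerivAt_softmax_line_dotProduct z u
      (w := fun _ => c) (w' := 0) fun a => hasDerivAt_const x (c a)
  have := abs_sub_le_of_abs_hasDerivAt_le hderiv fun x =>
    abs_dotProduct_le_of_mem_stdSimplex (softmax_mem_stdSimplex (z + x • u)) fun a => by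
      rw [abs_mul]
      exact mul_le_mul (abs_sub_dotProduct_le_of_mem_stdSimplex
        (softmax_mem_stdSimplex _) u a) (hc a) (abs_nonneg _) (Real.sqrt_nonneg _)
  simpa only [one_smul, zero_smul, add_zero, sub_dotProduct] using this

end Bounds

theorem mean_le_log_sum_exp (z : A → ℝ) :
    (∑ a, z a) / Fintype.card A ≤ Real.log (∑ a, Real.exp (z a)) := by
  rw [div_le_iff₀ (by exact_mod_cast Fintype.card_pos), mul_comm, ← nsmul_eq_mul,
    ← Finset.card_univ]
  refine Finset.sum_le_card_nsmul _ _ _ fun a _ => ?_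
  rw [Real.le_log_iff_exp_le (sum_exp_pos z)]
  exact Finset.single_le_sum (f := fun a => Real.exp (z a)) (fun i _ => (Real.exp_pos _).le)
    (Finset.mem_univ a)

theorem exp_div_card_le_softmax {z : A → ℝ} {l : ℝ} (hz : ∀ a, l ≤ z a) (a : A) :
    Real.exp (Fintype.card A * l - ∑ b, z b) / Fintype.card A ≤ softmax z a := by
  have hupper (b : A) : z b ≤ l + (∑ c, z c - Fintype.card A * l) := by
    rw [← sub_le_iff_le_add', ← nsmul_eq_mul, ← Finset.card_univ, ← Finset.sum_const,
      ← Finset.sum_sub_distrib]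
    exact Finset.single_le_sum (f := fun c => z c - l) (fun c _ => sub_nonneg.2 (hz c))
      (Finset.mem_univ b)
  have hsum : ∑ b, Real.exp (z b) ≤
      Fintype.card A * Real.exp (l + (∑ c, z c - Fintype.card A * l)) := by
    rw [← nsmul_eq_mul, ← Finset.card_univ]
    exact Finset.sum_le_card_nsmul _ _ _ fun b _ => Real.exp_le_exp.2 (hupper b)
  have : (0 : ℝ) < Fintype.card A := by exact_mod_cast Fintype.card_pos
  calc Real.exp (Fintype.card A * l - ∑ b, z b) / Fintype.card A
      = Real.exp l / (Fintype.card A * Real.exp (l + (∑ c, z c - Fintype.card A * l))) := by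
        rw [div_mul_eq_div_div_swap, ← Real.exp_sub]
        congr 2
        ring
    _ ≤ softmax z a :=
        div_le_div₀ (Real.exp_pos _).le (Real.exp_le_exp.2 (hz a)) (sum_exp_pos z) hsum

end Softmax

theorem isPolicy_softmaxPolicy {S A : Type*} [Fintype A] [Nonempty A]
    (θ : EuclideanSpace ℝ (S × A)) : IsPolicy (softmaxPolicy θ) :=
  fun s => softmax_mem_stdSimplex fun a => θ (s, a)

theorem continuous_softmaxPolicy {S A : Type*} [Fintype A] [Nonempty A] :
    Continuous (softmaxPolicy : EuclideanSpace ℝ (S × A) → S → A → ℝ) :=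
  continuous_pi fun s => continuous_pi fun a =>
    Continuous.div (by fun_prop) (by fun_prop) fun θ => (sum_exp_pos fun a => θ (s, a)).ne'

namespace FiniteMDP

section Discount

variable {S A : Type*} [Fintype S] (M : FiniteMDP S A)

theorem discount_nonneg : 0 ≤ M.γ := M.γ_mem.1

theorem one_sub_discount_pos : 0 < 1 - M.γ := sub_pos.2 M.γ_mem.2

end Discount

section Transition

variable {S A : Type*} [Fintype S] [Fintype A] (M : FiniteMDP S A)

theorem transMatrix_mulVec (π : S → A → ℝ) (x : S → ℝ) (s : S) :
    (M.transMatrix π *ᵥ x) s = π s ⬝ᵥ fun a => M.P s a ⬝ᵥ x := by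
  simp only [transMatrix, mulVec, dotProduct, of_apply, Finset.sum_mul, Finset.mul_sum, mul_assoc]
  exact Finset.sum_comm

theorem continuous_transMatrix : Continuous (M.transMatrix : (S → A → ℝ) → Matrix S S ℝ) :=
  continuous_matrix fun s s' => by
    simp only [transMatrix, of_apply]
    fun_prop

/-- The bound `(1 + lam log |A|) / (1 - γ)` on regularized values. -/
def valueBound (lam : ℝ) : ℝ := (1 + lam * Real.log (Fintype.card A)) / (1 - M.γ)

theorem valueBound_pos {lam : ℝ} (hlam : 0 ≤ lam) : 0 < M.valueBound lam :=
  div_pos (add_pos_of_pos_of_nonneg one_pos (mul_nonneg hlam (Real.log_natCast_nonneg _)))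
    M.one_sub_discount_pos

end Transition

section Value

variable {S A : Type*} [Fintype S] [DecidableEq S] [Fintype A] {M : FiniteMDP S A}
  {π π' : S → A → ℝ}

theorem transMatrix_mem_rowStochastic (hπ : IsPolicy π) : M.transMatrix π ∈ rowStochastic ℝ S := by
  refine mem_rowStochastic_iff_sum.2 ⟨fun s s' => Finset.sum_nonneg fun a _ =>
    mul_nonneg ((hπ s).1 a) ((M.P_mem s a).1 s'), fun s => ?_⟩
  simp only [transMatrix, of_apply]
  rw [Finset.sum_comm]
  simp only [← Finset.mul_sum, (M.P_mem s _).2, mul_one, (hπ s).2]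

theorem value_eq_discountedResolvent_mulVec (hπ : IsPolicy π) (lam : ℝ) :
    M.value lam π = discountedResolvent M.γ (M.transMatrix π) *ᵥ
      fun s => entropicGain lam (M.r s) (π s) := by
  have hreward (s : S) : ∑ a, π s a * (M.r s a - lam * negEntropy (π s)) =
      entropicGain lam (M.r s) (π s) :=
    dotProduct_sub_const_of_mem_stdSimplex (hπ s) (M.r s) _
  ext s
  simp only [value, hreward, discountedResolvent, mulVec, dotProduct, of_apply, ← tsum_mul_right]
  rw [← Summable.tsum_finsetSum fun i _ => (summable_discount_mul_pow_apply M.γ_mem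
    (transMatrix_mem_rowStochastic hπ) s i).mul_right _]
  simp only [Finset.mul_sum, mul_assoc]

variable (M) in
/-- The state-action value `Q^π(s, a) = r(s, a) + γ ∑ s', P(s' | s, a) V^π(s')`; the entropy of the
action played in `s` itself is not counted. -/
def qValue (lam : ℝ) (π : S → A → ℝ) (s : S) (a : A) : ℝ :=
  M.r s a + M.γ * M.P s a ⬝ᵥ M.value lam π

theorem entropicGain_qValue (lam : ℝ) (π π' : S → A → ℝ) (s : S) :
    entropicGain lam (M.qValue lam π s) (π' s) =
      entropicGain lam (M.r s) (π' s) + M.γ * (M.transMatrix π' *ᵥ M.value lam π) s := by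
  rw [transMatrix_mulVec, ← smul_eq_mul, ← dotProduct_smul, ← entropicGain_add]
  rfl

theorem value_eq_entropicGain_qValue (hπ : IsPolicy π) (lam : ℝ) (s : S) :
    M.value lam π s = entropicGain lam (M.qValue lam π s) (π s) := by
  rw [entropicGain_qValue, value_eq_discountedResolvent_mulVec hπ]
  exact congrFun (discountedResolvent_mulVec_eq_add M.γ_mem (transMatrix_mem_rowStochastic hπ) _) s

variable (M) in
/-- The advantage in the state `s` of playing `π'` there for one step over playing `π` throughout,
the play continuing with `π`. -/
def policyAdvantage (lam : ℝ) (π π' : S → A → ℝ) (s : S) : ℝ :=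
  entropicGain lam (M.qValue lam π s) (π' s) - M.value lam π s

theorem value_sub_value_eq_policyAdvantage_add (hπ' : IsPolicy π') (lam : ℝ) :
    M.value lam π' - M.value lam π = M.policyAdvantage lam π π' +
      M.γ • (M.transMatrix π' *ᵥ (M.value lam π' - M.value lam π)) := by
  ext s
  simp only [Pi.add_apply, Pi.sub_apply, Pi.smul_apply, smul_eq_mul, mulVec_sub]
  rw [value_eq_entropicGain_qValue hπ', policyAdvantage, entropicGain_qValue, entropicGain_qValue]
  ring

theorem value_sub_value (hπ' : IsPolicy π') (lam : ℝ) :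
    M.value lam π' - M.value lam π =
      discountedResolvent M.γ (M.transMatrix π') *ᵥ M.policyAdvantage lam π π' :=
  eq_discountedResolvent_mulVec M.γ_mem (transMatrix_mem_rowStochastic hπ')
    (value_sub_value_eq_policyAdvantage_add hπ' lam)

theorem continuousOn_value (M : FiniteMDP S A) (lam : ℝ) (s : S) :
    ContinuousOn (fun π : S → A → ℝ => M.value lam π s) {π | IsPolicy π} := by
  have hgain (s' : S) : Continuous fun π : S → A → ℝ => entropicGain lam (M.r s') (π s') := by
    have hentropy : Continuous fun π : S → A → ℝ => negEntropy (π s') :=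
      continuous_negEntropy.comp (continuous_apply s')
    simp only [entropicGain, dotProduct]
    fun_prop
  have hresolvent (s' : S) : ContinuousOn
      (fun π => discountedResolvent M.γ (M.transMatrix π) s s') {π | IsPolicy π} :=
    (continuousOn_discountedResolvent_apply M.γ_mem s s').comp
      M.continuous_transMatrix.continuousOn fun π hπ => transMatrix_mem_rowStochastic hπ
  exact (continuousOn_finsetSum _ fun s' _ =>
    (hresolvent s').mul (hgain s').continuousOn).congr fun π hπ =>
      congrFun (value_eq_discountedResolvent_mulVec hπ lam) s

section Bounds

variable {lam : ℝ}

theorem value_nonneg (hlam : 0 ≤ lam) (hπ : IsPolicy π) : 0 ≤ M.value lam π := by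
  rw [value_eq_discountedResolvent_mulVec hπ]
  exact discountedResolvent_mulVec_nonneg M.discount_nonneg (transMatrix_mem_rowStochastic hπ)
    fun s => entropicGain_nonneg hlam (fun a => (M.r_mem s a).1) (hπ s)

theorem value_le_valueBound (hlam : 0 ≤ lam) (hπ : IsPolicy π) (s : S) :
    M.value lam π s ≤ M.valueBound lam := by
  rw [value_eq_discountedResolvent_mulVec hπ]
  exact discountedResolvent_mulVec_le M.γ_mem (transMatrix_mem_rowStochastic hπ)
    (fun s => entropicGain_le hlam (fun a => (M.r_mem s a).2) (hπ s)) s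

theorem qValue_nonneg (hlam : 0 ≤ lam) (hπ : IsPolicy π) (s : S) : 0 ≤ M.qValue lam π s :=
  fun a => add_nonneg (M.r_mem s a).1 (mul_nonneg M.discount_nonneg
    (dotProduct_nonneg_of_nonneg (M.P_mem s a).1 (value_nonneg hlam hπ)))

theorem qValue_le (hlam : 0 ≤ lam) (hπ : IsPolicy π) (s : S) (a : A) :
    M.qValue lam π s a ≤ M.valueBound lam - lam * Real.log (Fintype.card A) := by
  have hnext := mul_le_mul_of_nonneg_left (dotProduct_le_of_mem_stdSimplex (M.P_mem s a)
    (value_le_valueBound (M := M) hlam hπ)) M.discount_nonneg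
  have hbound : 1 + lam * Real.log (Fintype.card A) = (1 - M.γ) * M.valueBound lam :=
    (mul_div_cancel₀ _ M.one_sub_discount_pos.ne').symm
  have hreward := (M.r_mem s a).2
  rw [qValue]
  linarith

end Bounds

section Occupancy

variable (M) in
/-- The unnormalized discounted visitation measure `μᵀ (1 - γ P_π)⁻¹` of `π` started from `μ`. -/
def occupancy (π : S → A → ℝ) : S → ℝ :=
  M.μ ᵥ* discountedResolvent M.γ (M.transMatrix π)

theorem visitation_eq (M : FiniteMDP S A) (π : S → A → ℝ) (s : S) :
    M.visitation π s = (1 - M.γ) * M.occupancy π s := by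
  simp only [visitation, occupancy, discountedResolvent, vecMul, dotProduct, of_apply,
    Finset.mul_sum, mul_left_comm]

theorem init_le_occupancy (hπ : IsPolicy π) (s : S) : M.μ s ≤ M.occupancy π s :=
  have hP := transMatrix_mem_rowStochastic (M := M) hπ
  calc M.μ s ≤ M.μ s * discountedResolvent M.γ (M.transMatrix π) s s :=
        le_mul_of_one_le_right (M.μ_mem.1 s) (one_le_discountedResolvent_diag M.γ_mem hP s)
    _ ≤ M.occupancy π s :=
        Finset.single_le_sum
          (f := fun i => M.μ i * discountedResolvent M.γ (M.transMatrix π) i s)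
          (fun i _ => mul_nonneg (M.μ_mem.1 i) (discountedResolvent_nonneg M.γ_mem.1 hP i s))
          (Finset.mem_univ s)

theorem occupancy_nonneg (hπ : IsPolicy π) (s : S) : 0 ≤ M.occupancy π s :=
  (M.μ_mem.1 s).trans (init_le_occupancy hπ s)

theorem sum_occupancy (hπ : IsPolicy π) : ∑ s, M.occupancy π s = 1 / (1 - M.γ) := by
  rw [← dotProduct_one, occupancy, ← dotProduct_mulVec,
    discountedResolvent_mulVec_one M.γ_mem (transMatrix_mem_rowStochastic hπ)]
  exact dotProduct_const_of_mem_stdSimplex M.μ_mem _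

theorem occupancy_le (hπ : IsPolicy π) (s : S) : M.occupancy π s ≤ 1 / (1 - M.γ) := by
  rw [← sum_occupancy hπ]
  exact Finset.single_le_sum (fun i _ => occupancy_nonneg hπ i) (Finset.mem_univ s)

theorem objective_sub_objective_eq_dotProduct (M : FiniteMDP S A) (lam : ℝ) (π π' : S → A → ℝ) :
    M.objective lam π' - M.objective lam π = M.μ ⬝ᵥ (M.value lam π' - M.value lam π) :=
  (dotProduct_sub _ _ _).symm

theorem objective_sub_objective (hπ' : IsPolicy π') (lam : ℝ) :
    M.objective lam π' - M.objective lam π =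
      M.occupancy π' ⬝ᵥ M.policyAdvantage lam π π' := by
  rw [objective_sub_objective_eq_dotProduct, value_sub_value hπ', dotProduct_mulVec]
  rfl

/-- The performance difference seen from the occupancy of the old policy: what replaces the change
of occupancy is the effect of the changed transitions on the change of value, a product of two
differences. -/
theorem objective_sub_objective_eq_add (hπ : IsPolicy π) (hπ' : IsPolicy π') (lam : ℝ) :
    M.objective lam π' - M.objective lam π =
      M.occupancy π ⬝ᵥ (M.policyAdvantage lam π π' + M.γ •
        fun s => (π' s - π s) ⬝ᵥ fun a => M.P s a ⬝ᵥ (M.value lam π' - M.value lam π)) := by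
  rw [objective_sub_objective_eq_dotProduct, occupancy, ← dotProduct_mulVec]
  congr 1
  refine eq_discountedResolvent_mulVec M.γ_mem (transMatrix_mem_rowStochastic hπ) ?_
  conv_lhs => rw [value_sub_value_eq_policyAdvantage_add hπ']
  rw [add_assoc, ← smul_add]
  congr 2
  ext s
  simp only [Pi.add_apply, transMatrix_mulVec, sub_dotProduct, sub_add_cancel]

end Occupancy

end Value

section Optimality

variable {S A : Type*} [Fintype S] [DecidableEq S] [Fintype A] {M : FiniteMDP S A} {lam : ℝ}
  {π πstar : S → A → ℝ}

theorem exists_isOptimalPolicy [Nonempty A] (M : FiniteMDP S A) (lam : ℝ) :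
    ∃ πstar : S → A → ℝ, M.IsOptimalPolicy lam πstar := by
  have hcompact : IsCompact {π : S → A → ℝ | IsPolicy π} := by
    simpa only [IsPolicy, Set.pi, Set.mem_univ, forall_const] using
      isCompact_univ_pi fun _ : S => isCompact_stdSimplex ℝ A
  have hcont : ContinuousOn (M.objective lam) {π : S → A → ℝ | IsPolicy π} :=
    continuousOn_finsetSum _ fun s _ => continuousOn_const.mul (M.continuousOn_value lam s)
  obtain ⟨πstar, hpolicy, hmax⟩ := hcompact.exists_isMaxOn ⟨_, isPolicy_softmaxPolicy 0⟩ hcont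
  exact ⟨πstar, hpolicy, fun π hπ => hmax hπ⟩

theorem policyAdvantage_update (hπ : IsPolicy π) (lam : ℝ) (s : S) (q : A → ℝ) :
    M.policyAdvantage lam π (Function.update π s q) =
      Pi.single s (entropicGain lam (M.qValue lam π s) q - M.value lam π s) := by
  ext s'
  rcases eq_or_ne s' s with rfl | hs
  · rw [policyAdvantage, Function.update_self, Pi.single_eq_same]
  · rw [policyAdvantage, Function.update_of_ne hs, Pi.single_eq_of_ne hs,
      ← value_eq_entropicGain_qValue hπ, sub_self]

theorem IsOptimalPolicy.policyAdvantage_nonpos (h : M.IsOptimalPolicy lam πstar)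
    (hμ : ∀ s, 0 < M.μ s) (hπ : IsPolicy π) (s : S) : M.policyAdvantage lam πstar π s ≤ 0 := by
  have hupdate : IsPolicy (Function.update πstar s (π s)) :=
    (Function.forall_update_iff πstar fun _ p => p ∈ stdSimplex ℝ A).2 ⟨hπ s, fun s' _ => h.1 s'⟩
  have hdiff := objective_sub_objective (M := M) (π := πstar) hupdate lam
  rw [policyAdvantage_update h.1, dotProduct_single] at hdiff
  exact nonpos_of_mul_nonpos_right (hdiff.symm.trans_le (sub_nonpos.2 (h.2 _ hupdate)))
    ((hμ s).trans_le (init_le_occupancy hupdate s))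

theorem IsOptimalPolicy.value_le (h : M.IsOptimalPolicy lam πstar) (hμ : ∀ s, 0 < M.μ s)
    (hπ : IsPolicy π) : M.value lam π ≤ M.value lam πstar := fun s => by
  have hle := discountedResolvent_mulVec_le M.γ_mem (transMatrix_mem_rowStochastic (M := M) hπ)
    (h.policyAdvantage_nonpos hμ hπ) s
  rw [← value_sub_value hπ, zero_div] at hle
  exact sub_nonpos.1 hle

end Optimality

section Mismatch

variable {S A : Type*} [Fintype S] [DecidableEq S] [Fintype A] {M : FiniteMDP S A}
  {π π' : S → A → ℝ}

theorem one_sub_discount_le_norm_visitation_div [Nonempty S] (hμ : ∀ s, 0 < M.μ s)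
    (hπ : IsPolicy π) : 1 - M.γ ≤ ‖fun s => M.visitation π s / M.μ s‖ := by
  obtain ⟨s⟩ := ‹Nonempty S›
  refine le_trans ?_ (apply_le_norm (fun s => M.visitation π s / M.μ s) s)
  rw [le_div_iff₀ (hμ s), visitation_eq]
  exact mul_le_mul_of_nonneg_left (init_le_occupancy hπ s) M.one_sub_discount_pos.le

theorem one_sub_discount_mul_occupancy_le (hμ : ∀ s, 0 < M.μ s) (hπ : IsPolicy π)
    (π' : S → A → ℝ) (s : S) :
    (1 - M.γ) * M.occupancy π' s ≤
      ‖fun s => M.visitation π' s / M.μ s‖ * M.occupancy π s := by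
  rw [← visitation_eq]
  refine le_trans ?_ (mul_le_mul_of_nonneg_left (init_le_occupancy hπ s) (norm_nonneg _))
  rw [← div_le_iff₀ (hμ s)]
  exact apply_le_norm (fun s => M.visitation π' s / M.μ s) s

end Mismatch

end FiniteMDP

theorem sum_row_sq_le_norm_sq {S A : Type*} [Fintype S] [Fintype A]
    (u : EuclideanSpace ℝ (S × A)) (s : S) : ∑ a, u (s, a) ^ 2 ≤ ‖u‖ ^ 2 := by
  rw [EuclideanSpace.real_norm_sq_eq, Fintype.sum_prod_type]
  exact Finset.single_le_sum (f := fun s => ∑ a, u (s, a) ^ 2)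
    (fun i _ => Finset.sum_nonneg fun a _ => sq_nonneg _) (Finset.mem_univ s)

theorem sqrt_two_mul_sum_row_sq_le {S A : Type*} [Fintype S] [Fintype A]
    (u : EuclideanSpace ℝ (S × A)) (s : S) : √(2 * ∑ a, u (s, a) ^ 2) ≤ √(2 * ‖u‖ ^ 2) :=
  Real.sqrt_le_sqrt (mul_le_mul_of_nonneg_left (sum_row_sq_le_norm_sq u s) zero_le_two)

namespace FiniteMDP

section LearningRate

variable {S A : Type*} [Fintype S] [Fintype A] (M : FiniteMDP S A) {lam : ℝ}

theorem pgRate_pos (hlam : 0 ≤ lam) : 0 < M.pgRate lam := by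
  have hdiscount := M.one_sub_discount_pos
  have := Real.log_natCast_nonneg (Fintype.card A)
  rw [pgRate]
  positivity

theorem mul_pgRate_le_one_div_four (hlam : 0 ≤ lam) : lam * M.pgRate lam ≤ 1 / 4 := by
  have hpow := pow_le_one₀ (n := 3) M.one_sub_discount_pos.le (by linarith [M.discount_nonneg])
  have hlog := Real.log_natCast_nonneg (Fintype.card A)
  have hdiscount := mul_le_of_le_one_right hlam hpow
  have hentropy := mul_nonneg hlam hlog
  rw [pgRate, mul_div_assoc', div_le_div_iff₀ (by positivity) (by norm_num)]
  linarith

theorem curvature_le_one_div_pgRate (hlam : 0 ≤ lam) :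
    ((M.valueBound lam + lam) / 2 + M.γ * (2 * (M.valueBound lam / (1 - M.γ)))) / (1 - M.γ) ≤
      1 / (4 * M.pgRate lam) := by
  have hx := M.one_sub_discount_pos
  have hγ := M.discount_nonneg
  have hlog := Real.log_natCast_nonneg (Fintype.card A)
  rw [valueBound, pgRate]
  generalize Real.log (Fintype.card A) = H at hlog ⊢
  have hlhs : (((1 + lam * H) / (1 - M.γ) + lam) / 2 +
      M.γ * (2 * ((1 + lam * H) / (1 - M.γ) / (1 - M.γ)))) / (1 - M.γ) =
      (2 * (1 + lam * H) - 3 / 2 * ((1 - M.γ) * (1 + lam * H)) + lam / 2 * (1 - M.γ) ^ 2) /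
        (1 - M.γ) ^ 3 := by
    field_simp
    ring
  have hrhs : 1 / (4 * ((1 - M.γ) ^ 3 / (8 + lam * (4 + 8 * H)))) =
      (2 + lam * (1 + 2 * H)) / (1 - M.γ) ^ 3 := by
    field_simp
    ring
  rw [hlhs, hrhs]
  refine div_le_div_of_nonneg_right ?_ (by positivity)
  have hsq : lam / 2 * (1 - M.γ) ^ 2 ≤ lam :=
    (mul_le_of_le_one_right (by positivity) (pow_le_one₀ hx.le (by linarith))).trans
      (half_le_self hlam)
  have hlin : 0 ≤ (1 - M.γ) * (1 + lam * H) := by positivity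
  linarith

end LearningRate

section PolicyGradient

variable {S A : Type*} [Fintype S] [DecidableEq S] [Fintype A]

/-- The soft advantage `A^π(s, a) = Q^π(s, a) - lam log π(a|s) - V^π(s)` of the action `a`. -/
def softAdvantage (M : FiniteMDP S A) (lam : ℝ) (π : S → A → ℝ) (s : S) : A → ℝ :=
  entropicAdvantage lam (M.qValue lam π s) (π s)

/-- The gradient of `θ ↦ J(π_θ, lam)` in the closed form given by the policy gradient theorem. -/
def policyGradient (M : FiniteMDP S A) (lam : ℝ) (θ : EuclideanSpace ℝ (S × A)) :
    EuclideanSpace ℝ (S × A) :=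
  WithLp.toLp 2 fun x => M.occupancy (softmaxPolicy θ) x.1 *
    (softmaxPolicy θ x.1 x.2 * M.softAdvantage lam (softmaxPolicy θ) x.1 x.2)

theorem inner_policyGradient (M : FiniteMDP S A) (lam : ℝ) (θ u : EuclideanSpace ℝ (S × A)) :
    inner ℝ (M.policyGradient lam θ) u = M.occupancy (softmaxPolicy θ) ⬝ᵥ fun s =>
      entropicSlope lam (M.qValue lam (softmaxPolicy θ) s) (fun a => θ (s, a))
        fun a => u (s, a) := by
  rw [PiLp.inner_apply, Fintype.sum_prod_type]
  refine Finset.sum_congr rfl fun s _ => ?_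
  simp only [entropicSlope, dotProduct, Finset.mul_sum]
  refine Finset.sum_congr rfl fun a _ => ?_
  change u (s, a) * (M.occupancy (softmaxPolicy θ) s * (softmaxPolicy θ s a *
    M.softAdvantage lam (softmaxPolicy θ) s a)) = M.occupancy (softmaxPolicy θ) s *
      (softmaxPolicy θ s a * (M.softAdvantage lam (softmaxPolicy θ) s a * u (s, a)))
  ring

section Gradient

variable [Nonempty A] {M : FiniteMDP S A} {lam : ℝ}

section Smoothness

variable (hlam : 0 ≤ lam) (θ u : EuclideanSpace ℝ (S × A)) (s : S)

include hlam

theorem abs_policyAdvantage_softmaxPolicy_add_le :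
    |M.policyAdvantage lam (softmaxPolicy θ) (softmaxPolicy (θ + u)) s| ≤
      √(2 * ‖u‖ ^ 2) * M.valueBound lam := by
  have hπ := isPolicy_softmaxPolicy θ
  have hlip := abs_entropicGain_softmax_add_sub_le hlam (qValue_nonneg (M := M) hlam hπ s)
    (qValue_le hlam hπ s) (fun a => θ (s, a)) fun a => u (s, a)
  rw [sub_add_cancel] at hlip
  rw [policyAdvantage, value_eq_entropicGain_qValue hπ]
  exact hlip.trans (mul_le_mul_of_nonneg_right (sqrt_two_mul_sum_row_sq_le u s)
    (M.valueBound_pos hlam).le)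

theorem abs_value_softmaxPolicy_add_sub_le :
    |(M.value lam (softmaxPolicy (θ + u)) - M.value lam (softmaxPolicy θ)) s| ≤
      √(2 * ‖u‖ ^ 2) * M.valueBound lam / (1 - M.γ) := by
  have hπ' := isPolicy_softmaxPolicy (θ + u)
  rw [value_sub_value hπ']
  exact abs_discountedResolvent_mulVec_le M.γ_mem (transMatrix_mem_rowStochastic hπ')
    (abs_policyAdvantage_softmaxPolicy_add_le hlam θ u) s

theorem abs_softmaxPolicy_add_sub_dotProduct_value_sub_le :
    |(softmaxPolicy (θ + u) s - softmaxPolicy θ s) ⬝ᵥ fun a => M.P s a ⬝ᵥ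
        (M.value lam (softmaxPolicy (θ + u)) - M.value lam (softmaxPolicy θ))| ≤
      2 * (M.valueBound lam / (1 - M.γ)) * ‖u‖ ^ 2 := by
  have hnext (a : A) := abs_dotProduct_le_of_mem_stdSimplex (M.P_mem s a)
    (abs_value_softmaxPolicy_add_sub_le (M := M) hlam θ u)
  refine (abs_softmax_add_sub_dotProduct_le hnext (fun a => θ (s, a)) fun a => u (s, a)).trans ?_
  have hB := (M.valueBound_pos hlam).le
  have hx := M.one_sub_discount_pos.le
  calc √(2 * ∑ a, u (s, a) ^ 2) * (√(2 * ‖u‖ ^ 2) * M.valueBound lam / (1 - M.γ))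
      ≤ √(2 * ‖u‖ ^ 2) * (√(2 * ‖u‖ ^ 2) * M.valueBound lam / (1 - M.γ)) :=
        mul_le_mul_of_nonneg_right (sqrt_two_mul_sum_row_sq_le u s) (by positivity)
    _ = √(2 * ‖u‖ ^ 2) * √(2 * ‖u‖ ^ 2) * (M.valueBound lam / (1 - M.γ)) := by ring
    _ = 2 * (M.valueBound lam / (1 - M.γ)) * ‖u‖ ^ 2 := by
        rw [Real.mul_self_sqrt (by positivity)]
        ring

theorem entropicSlope_sub_le_policyAdvantage_softmaxPolicy_add :
    entropicSlope lam (M.qValue lam (softmaxPolicy θ) s) (fun a => θ (s, a))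
        (fun a => u (s, a)) - (M.valueBound lam + lam) / 2 * ‖u‖ ^ 2 ≤
      M.policyAdvantage lam (softmaxPolicy θ) (softmaxPolicy (θ + u)) s := by
  have hπ := isPolicy_softmaxPolicy θ
  have hcurv := entropicGain_softmax_add_ge hlam (qValue_nonneg (M := M) hlam hπ s)
    (qValue_le hlam hπ s) (fun a => θ (s, a)) fun a => u (s, a)
  have hrow := mul_le_mul_of_nonneg_left (sum_row_sq_le_norm_sq u s)
    (add_nonneg (M.valueBound_pos hlam).le hlam)
  rw [sub_add_cancel] at hcurv
  rw [policyAdvantage, value_eq_entropicGain_qValue hπ, le_sub_iff_add_le']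
  refine le_trans ?_ hcurv
  change entropicGain _ _ (softmax _) + _ ≤ _
  linarith

theorem objective_softmaxPolicy_add_ge :
    M.objective lam (softmaxPolicy θ) + inner ℝ (M.policyGradient lam θ) u -
        ‖u‖ ^ 2 / (4 * M.pgRate lam) ≤
      M.objective lam (softmaxPolicy (θ + u)) := by
  have hπ := isPolicy_softmaxPolicy θ
  set c := (M.valueBound lam + lam) / 2 + M.γ * (2 * (M.valueBound lam / (1 - M.γ)))
  have hstate (s : S) := add_le_add
    (entropicSlope_sub_le_policyAdvantage_softmaxPolicy_add (M := M) hlam θ u s)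
    (mul_le_mul_of_nonneg_left (neg_le_of_abs_le
      (abs_softmaxPolicy_add_sub_dotProduct_value_sub_le (M := M) hlam θ u s)) M.discount_nonneg)
  have hgap : inner ℝ (M.policyGradient lam θ) u - c / (1 - M.γ) * ‖u‖ ^ 2 ≤
      M.objective lam (softmaxPolicy (θ + u)) - M.objective lam (softmaxPolicy θ) := by
    rw [objective_sub_objective_eq_add hπ (isPolicy_softmaxPolicy (θ + u)), inner_policyGradient]
    calc _ = M.occupancy (softmaxPolicy θ) ⬝ᵥ fun s => entropicSlope lam
            (M.qValue lam (softmaxPolicy θ) s) (fun a => θ (s, a)) (fun a => u (s, a)) -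
              c * ‖u‖ ^ 2 := by
          simp only [dotProduct, mul_sub, Finset.sum_sub_distrib, ← Finset.sum_mul,
            sum_occupancy hπ]
          ring
      _ ≤ _ := dotProduct_le_dotProduct_of_nonneg_left
          (fun s => le_of_eq_of_le (by ring) (hstate s)) (occupancy_nonneg hπ)
  have hc := mul_le_mul_of_nonneg_right (M.curvature_le_one_div_pgRate hlam) (sq_nonneg ‖u‖)
  rw [one_div_mul_eq_div] at hc
  linarith

end Smoothness

theorem continuous_policyGradient (M : FiniteMDP S A) (lam : ℝ) :
    Continuous (M.policyGradient lam) := by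
  have hπ (s : S) (a : A) : Continuous fun θ : EuclideanSpace ℝ (S × A) => softmaxPolicy θ s a :=
    (continuous_apply_apply s a).comp continuous_softmaxPolicy
  have hocc (s : S) : Continuous fun θ : EuclideanSpace ℝ (S × A) =>
      M.occupancy (softmaxPolicy θ) s :=
    continuous_finsetSum _ fun s₀ _ => continuous_const.mul
      ((continuousOn_discountedResolvent_apply M.γ_mem s₀ s).comp_continuous
        (M.continuous_transMatrix.comp continuous_softmaxPolicy)
        fun θ => transMatrix_mem_rowStochastic (isPolicy_softmaxPolicy θ))
  have hvalue (s : S) : Continuous fun θ : EuclideanSpace ℝ (S × A) =>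
      M.value lam (softmaxPolicy θ) s :=
    (M.continuousOn_value lam s).comp_continuous continuous_softmaxPolicy isPolicy_softmaxPolicy
  have hlog (s : S) (a : A) : Continuous fun θ : EuclideanSpace ℝ (S × A) =>
      Real.log (softmaxPolicy θ s a) :=
    (hπ s a).log fun θ => (softmax_pos (fun a => θ (s, a)) a).ne'
  refine (PiLp.continuous_toLp 2 _).comp (continuous_pi fun x =>
    (hocc x.1).mul ((hπ x.1 x.2).mul ?_))
  simp only [softAdvantage, entropicAdvantage,
    ← value_eq_entropicGain_qValue (isPolicy_softmaxPolicy _), qValue, dotProduct]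
  fun_prop

theorem hasGradientAt_objective_softmaxPolicy (hlam : 0 ≤ lam)
    (θ : EuclideanSpace ℝ (S × A)) :
    HasGradientAt (fun θ : EuclideanSpace ℝ (S × A) => M.objective lam (softmaxPolicy θ))
      (M.policyGradient lam θ) θ :=
  hasGradientAt_of_add_inner_sub_le (b := 1 / (4 * M.pgRate lam))
    (M.continuous_policyGradient lam) (fun θ u => by
      rw [one_div_mul_eq_div]
      exact objective_softmaxPolicy_add_ge hlam θ u) θ

end Gradient

end PolicyGradient

section Lojasiewicz

variable {S A : Type*} [Fintype S] [DecidableEq S] [Fintype A] {M : FiniteMDP S A}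
  {lam m c : ℝ} {π π' : S → A → ℝ}

theorem policyAdvantage_le_sum_softAdvantage_sq (hlam : 0 < lam) (hπ : IsPolicy π)
    (hπ₀ : ∀ s a, 0 < π s a) (hπ' : IsPolicy π') (s : S) :
    M.policyAdvantage lam π π' s ≤ (∑ a, M.softAdvantage lam π s a ^ 2) / (2 * lam) := by
  rw [policyAdvantage, value_eq_entropicGain_qValue hπ]
  exact entropicGain_sub_le_sum_entropicAdvantage_sq hlam _ (hπ s) (hπ₀ s) (hπ' s)

theorem objective_sub_objective_le_sum_softAdvantage_sq (hμ : ∀ s, 0 < M.μ s) (hlam : 0 < lam)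
    (hπ : IsPolicy π) (hπ₀ : ∀ s a, 0 < π s a) (hπ' : IsPolicy π') :
    2 * lam * (1 - M.γ) * (M.objective lam π' - M.objective lam π) ≤
      ‖fun s => M.visitation π' s / M.μ s‖ *
        (M.occupancy π ⬝ᵥ fun s => ∑ a, M.softAdvantage lam π s a ^ 2) := by
  rw [objective_sub_objective hπ', dotProduct, dotProduct, Finset.mul_sum, Finset.mul_sum]
  refine Finset.sum_le_sum fun s _ => ?_
  have hadv := policyAdvantage_le_sum_softAdvantage_sq (M := M) hlam hπ hπ₀ hπ' s
  rw [le_div_iff₀' (by positivity)] at hadv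
  have hocc := occupancy_nonneg (M := M) hπ' s
  calc 2 * lam * (1 - M.γ) * (M.occupancy π' s * M.policyAdvantage lam π π' s)
      = (1 - M.γ) * M.occupancy π' s * (2 * lam * M.policyAdvantage lam π π' s) := by ring
    _ ≤ (1 - M.γ) * M.occupancy π' s * ∑ a, M.softAdvantage lam π s a ^ 2 :=
        mul_le_mul_of_nonneg_left hadv (mul_nonneg M.one_sub_discount_pos.le hocc)
    _ ≤ ‖fun s => M.visitation π' s / M.μ s‖ * M.occupancy π s *
          ∑ a, M.softAdvantage lam π s a ^ 2 :=
        mul_le_mul_of_nonneg_right (one_sub_discount_mul_occupancy_le hμ hπ π' s)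
          (Finset.sum_nonneg fun a _ => sq_nonneg _)
    _ = _ := mul_assoc _ _ _

variable [Nonempty A] {θ : EuclideanSpace ℝ (S × A)}

theorem mul_occupancy_dotProduct_le_norm_policyGradient_sq (lam : ℝ) (hm₀ : 0 ≤ m)
    (hm : ∀ s, m ≤ M.μ s) (hc : ∀ s a, c ≤ softmaxPolicy θ s a ^ 2) :
    m * c * (M.occupancy (softmaxPolicy θ) ⬝ᵥ
        fun s => ∑ a, M.softAdvantage lam (softmaxPolicy θ) s a ^ 2) ≤
      ‖M.policyGradient lam θ‖ ^ 2 := by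
  have hπ := isPolicy_softmaxPolicy θ
  rw [EuclideanSpace.real_norm_sq_eq, Fintype.sum_prod_type]
  simp only [dotProduct, Finset.mul_sum]
  refine Finset.sum_le_sum fun s _ => Finset.sum_le_sum fun a _ => ?_
  have hocc := occupancy_nonneg (M := M) hπ s
  have hmocc := (hm s).trans (init_le_occupancy hπ s)
  calc m * c * (M.occupancy (softmaxPolicy θ) s *
          M.softAdvantage lam (softmaxPolicy θ) s a ^ 2)
      = m * M.occupancy (softmaxPolicy θ) s *
          (c * M.softAdvantage lam (softmaxPolicy θ) s a ^ 2) := by ring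
    _ ≤ M.occupancy (softmaxPolicy θ) s * M.occupancy (softmaxPolicy θ) s *
          (softmaxPolicy θ s a ^ 2 * M.softAdvantage lam (softmaxPolicy θ) s a ^ 2) :=
        mul_le_mul_of_nonneg (mul_le_mul_of_nonneg_right hmocc hocc)
          (mul_le_mul_of_nonneg_right (hc s a) (sq_nonneg _)) (mul_nonneg hm₀ hocc)
          (by positivity)
    _ = (M.policyGradient lam θ).ofLp (s, a) ^ 2 := by
        rw [policyGradient]
        ring

theorem objective_sub_objective_le_norm_policyGradient_sq (hμ : ∀ s, 0 < M.μ s) (hlam : 0 < lam)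
    (hm₀ : 0 ≤ m) (hm : ∀ s, m ≤ M.μ s) (hc₀ : 0 ≤ c) (hc : ∀ s a, c ≤ softmaxPolicy θ s a ^ 2)
    (hπ : IsPolicy π) :
    2 * lam * (1 - M.γ) * m * c *
        (M.objective lam π - M.objective lam (softmaxPolicy θ)) ≤
      ‖fun s => M.visitation π s / M.μ s‖ * ‖M.policyGradient lam θ‖ ^ 2 := by
  have hgap := objective_sub_objective_le_sum_softAdvantage_sq hμ hlam (isPolicy_softmaxPolicy θ)
    (fun s => softmax_pos fun a => θ (s, a)) hπ
  have hgrad := mul_occupancy_dotProduct_le_norm_policyGradient_sq lam hm₀ hm hc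
  have := mul_le_mul_of_nonneg_left hgap (mul_nonneg hm₀ hc₀)
  have := mul_le_mul_of_nonneg_left hgrad (norm_nonneg fun s => M.visitation π s / M.μ s)
  linarith

end Lojasiewicz

section InitialDistribution

variable {S A : Type*} [Fintype S]

theorem nonempty_states (M : FiniteMDP S A) : Nonempty S :=
  nonempty_of_mem_stdSimplex M.μ_mem

variable (M : FiniteMDP S A)

theorem init_le_one (s : S) : M.μ s ≤ 1 :=
  (mem_Icc_of_mem_stdSimplex M.μ_mem s).2

theorem iInf_init_le (s : S) : ⨅ s, M.μ s ≤ M.μ s :=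
  ciInf_le (Set.finite_range _).bddBelow s

variable {M} (hμ : ∀ s, 0 < M.μ s)

include hμ

theorem iInf_init_pos : 0 < ⨅ s, M.μ s := by
  have := M.nonempty_states
  obtain ⟨s, hs⟩ := exists_eq_ciInf_of_finite (f := M.μ)
  exact hs ▸ hμ s

theorem one_le_init_mul_norm_one_div_init (s : S) : 1 ≤ M.μ s * ‖fun s => 1 / M.μ s‖ := by
  rw [← div_le_iff₀' (hμ s)]
  exact apply_le_norm (fun s => 1 / M.μ s) s

theorem four_le_norm_one_div_init_div : 4 ≤ 4 * ‖fun s => 1 / M.μ s‖ / (1 - M.γ) := by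
  obtain ⟨s⟩ := M.nonempty_states
  have hnorm : 1 ≤ ‖fun s => 1 / M.μ s‖ :=
    (one_le_init_mul_norm_one_div_init hμ s).trans
      (mul_le_of_le_one_left (norm_nonneg _) (M.init_le_one s))
  rw [le_div_iff₀ M.one_sub_discount_pos]
  linarith [M.discount_nonneg]

theorem four_mul_norm_mul_exp_le_one {x : ℝ}
    (hx : Real.log (4 * ‖fun s => 1 / M.μ s‖ / (1 - M.γ)) ≤ x) :
    4 * ‖fun s => 1 / M.μ s‖ * Real.exp (-x) ≤ 1 := by
  have hE : 0 < 4 * ‖fun s => 1 / M.μ s‖ / (1 - M.γ) :=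
    zero_lt_four.trans_le (four_le_norm_one_div_init_div hμ)
  rw [Real.exp_neg, ← div_eq_mul_inv]
  refine div_le_one_of_le₀ (le_trans ?_ ((Real.log_le_iff_le_exp hE).1 hx)) (Real.exp_pos x).le
  exact le_div_self (by positivity) M.one_sub_discount_pos (by linarith [M.discount_nonneg])

end InitialDistribution

section Iterates

variable {S A : Type*} [Fintype S] [DecidableEq S] [Fintype A] {M : FiniteMDP S A}
  {lam : ℝ}

theorem neg_valueBound_le_softAdvantage {π : S → A → ℝ} (hlam : 0 ≤ lam) (hπ : IsPolicy π)
    (s : S) (a : A) : -M.valueBound lam ≤ M.softAdvantage lam π s a := by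
  rw [← sub_add_cancel (M.valueBound lam) (lam * Real.log (Fintype.card A))]
  exact neg_le_entropicAdvantage hlam (qValue_nonneg hlam hπ s) (qValue_le hlam hπ s) (hπ s) a

theorem softAdvantage_nonneg_of_mul_log_le {π : S → A → ℝ} (hlam : 0 ≤ lam) (hπ : IsPolicy π)
    {s : S} {a : A} (h : lam * Real.log (π s a) ≤ -M.valueBound lam) :
    0 ≤ M.softAdvantage lam π s a := by
  have hQ : 0 ≤ M.qValue lam π s a := qValue_nonneg hlam hπ s a
  have hV := value_le_valueBound (M := M) hlam hπ s
  rw [softAdvantage, entropicAdvantage, ← value_eq_entropicGain_qValue hπ]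
  linarith

theorem pgMinProbSq_le (M : FiniteMDP S A) (lam : ℝ) (θ₀ : EuclideanSpace ℝ (S × A)) (t : ℕ)
    (s : S) (a : A) : M.pgMinProbSq lam θ₀ ≤ M.pgPolicy lam θ₀ (t + 1) s a ^ 2 := by
  have hbdd : BddBelow (Set.range fun t : ℕ =>
      ⨅ s : S, ⨅ a : A, M.pgPolicy lam θ₀ (t + 1) s a ^ 2) := by
    refine ⟨0, ?_⟩
    rintro _ ⟨t, rfl⟩
    exact Real.iInf_nonneg fun s => Real.iInf_nonneg fun a => sq_nonneg _
  exact (ciInf_le hbdd t).trans ((ciInf_le (Set.finite_range _).bddBelow s).trans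
    (ciInf_le (Set.finite_range _).bddBelow a))

variable [Nonempty A]

theorem pgMinProbSq_le_one (M : FiniteMDP S A) (lam : ℝ) (θ₀ : EuclideanSpace ℝ (S × A)) :
    M.pgMinProbSq lam θ₀ ≤ 1 := by
  obtain ⟨s⟩ := M.nonempty_states
  have hπ := mem_Icc_of_mem_stdSimplex
    (isPolicy_softmaxPolicy (M.pgParam lam (M.pgRate lam) θ₀ 1) s) (Classical.arbitrary A)
  exact (M.pgMinProbSq_le lam θ₀ 0 s _).trans (pow_le_one₀ hπ.1 hπ.2)

theorem sum_policyGradient_row (M : FiniteMDP S A) (lam : ℝ) (θ : EuclideanSpace ℝ (S × A))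
    (s : S) : ∑ a, M.policyGradient lam θ (s, a) = 0 := by
  simp only [policyGradient, ← Finset.mul_sum]
  exact mul_eq_zero_of_right _
    (dotProduct_entropicAdvantage_self lam _ (isPolicy_softmaxPolicy θ s))

section GradientBounds

variable (hlam : 0 ≤ lam) (θ : EuclideanSpace ℝ (S × A)) (s : S) (a : A)

include hlam

theorem neg_valueBound_div_le_policyGradient :
    -(M.valueBound lam / (1 - M.γ)) ≤ M.policyGradient lam θ (s, a) := by
  have hπ := isPolicy_softmaxPolicy θ
  have hocc := occupancy_nonneg (M := M) hπ s
  have := M.one_sub_discount_pos.le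
  have hweight : M.occupancy (softmaxPolicy θ) s * softmaxPolicy θ s a ≤ 1 / (1 - M.γ) :=
    (mul_le_of_le_one_right hocc (mem_Icc_of_mem_stdSimplex (hπ s) a).2).trans (occupancy_le hπ s)
  calc -(M.valueBound lam / (1 - M.γ)) = 1 / (1 - M.γ) * -M.valueBound lam := by ring
    _ ≤ M.occupancy (softmaxPolicy θ) s * softmaxPolicy θ s a * -M.valueBound lam :=
        mul_le_mul_of_nonpos_right hweight (neg_nonpos.2 (M.valueBound_pos hlam).le)
    _ ≤ M.occupancy (softmaxPolicy θ) s * softmaxPolicy θ s a *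
          M.softAdvantage lam (softmaxPolicy θ) s a :=
        mul_le_mul_of_nonneg_left (neg_valueBound_le_softAdvantage hlam hπ s a)
          (mul_nonneg hocc ((hπ s).1 a))
    _ = M.policyGradient lam θ (s, a) := mul_assoc _ _ _

theorem policyGradient_nonneg_of_mul_log_le
    (h : lam * Real.log (softmaxPolicy θ s a) ≤ -M.valueBound lam) :
    0 ≤ M.policyGradient lam θ (s, a) :=
  have hπ := isPolicy_softmaxPolicy θ
  mul_nonneg (occupancy_nonneg hπ s)
    (mul_nonneg ((hπ s).1 a) (softAdvantage_nonneg_of_mul_log_le hlam hπ h))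

end GradientBounds

section Iteration

variable {η : ℝ} (θ θ₀ : EuclideanSpace ℝ (S × A)) (t : ℕ)

theorem min_le_add_smul_policyGradient (hlam : 0 < lam) (hη : 0 ≤ η) (s : S) (a : A) :
    min (θ (s, a)) ((∑ b, θ (s, b)) / Fintype.card A - M.valueBound lam / lam -
      η * (M.valueBound lam / (1 - M.γ))) ≤ (θ + η • M.policyGradient lam θ) (s, a) := by
  rw [PiLp.add_apply, PiLp.smul_apply, smul_eq_mul]
  rcases le_total (lam * Real.log (softmaxPolicy θ s a)) (-M.valueBound lam) with hlog | hlog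
  · exact (min_le_left _ _).trans (le_add_of_nonneg_right
      (mul_nonneg hη (policyGradient_nonneg_of_mul_log_le hlam.le θ s a hlog)))
  · refine (min_le_right _ _).trans ?_
    have hmean := mean_le_log_sum_exp fun b => θ (s, b)
    have hgrad := mul_le_mul_of_nonneg_left
      (neg_valueBound_div_le_policyGradient (M := M) hlam.le θ s a) hη
    change -M.valueBound lam ≤ lam * Real.log (softmax (fun b => θ (s, b)) a) at hlog
    rw [log_softmax, ← div_le_iff₀' hlam, neg_div] at hlog
    linarith

theorem pgParam_succ (hlam : 0 ≤ lam) (η : ℝ) :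
    M.pgParam lam η θ₀ (t + 1) =
      M.pgParam lam η θ₀ t + η • M.policyGradient lam (M.pgParam lam η θ₀ t) := by
  rw [pgParam, (hasGradientAt_objective_softmaxPolicy hlam _).gradient]

theorem sum_pgParam_row (hlam : 0 ≤ lam) (η : ℝ) (s : S) :
    ∑ a, M.pgParam lam η θ₀ t (s, a) = ∑ a, θ₀ (s, a) := by
  induction t with
  | zero => rfl
  | succ t ih =>
    simp only [pgParam_succ _ _ hlam, PiLp.add_apply, PiLp.smul_apply, smul_eq_mul,
      Finset.sum_add_distrib, ← Finset.mul_sum, sum_policyGradient_row, ih, mul_zero, add_zero]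

theorem min_le_pgParam (hlam : 0 < lam) (hη : 0 ≤ η) (s : S) (a : A) :
    min (θ₀ (s, a)) ((∑ b, θ₀ (s, b)) / Fintype.card A - M.valueBound lam / lam -
      η * (M.valueBound lam / (1 - M.γ))) ≤ M.pgParam lam η θ₀ t (s, a) := by
  induction t with
  | zero => exact min_le_left _ _
  | succ t ih =>
    rw [pgParam_succ _ _ hlam.le]
    refine le_trans (le_min ih ?_) (min_le_add_smul_policyGradient _ hlam hη s a)
    rw [sum_pgParam_row _ _ hlam.le]
    exact min_le_right _ _

theorem exists_le_pgParam (hlam : 0 < lam) (hη : 0 ≤ η) :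
    ∃ l, ∀ t s a, l ≤ M.pgParam lam η θ₀ t (s, a) := by
  obtain ⟨l, hl⟩ := (Set.finite_range fun x : S × A =>
    min (θ₀ x) ((∑ b, θ₀ (x.1, b)) / Fintype.card A - M.valueBound lam / lam -
      η * (M.valueBound lam / (1 - M.γ)))).bddBelow
  exact ⟨l, fun t s a => (hl ⟨(s, a), rfl⟩).trans (min_le_pgParam θ₀ t hlam hη s a)⟩

theorem exists_pos_le_pgPolicy (hlam : 0 < lam) :
    ∃ κ > 0, ∀ t s a, κ ≤ M.pgPolicy lam θ₀ t s a := by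
  have := M.nonempty_states
  obtain ⟨l, hl⟩ := exists_le_pgParam (M := M) θ₀ hlam (M.pgRate_pos hlam.le).le
  obtain ⟨s₀, hs₀⟩ := Finite.exists_min fun s : S =>
    Real.exp (Fintype.card A * l - ∑ a, θ₀ (s, a)) / Fintype.card A
  refine ⟨_, div_pos (Real.exp_pos _) (Nat.cast_pos.2 Fintype.card_pos),
    fun t s a => (hs₀ s).trans ?_⟩
  rw [← sum_pgParam_row (M := M) θ₀ t hlam.le (M.pgRate lam)]
  exact exp_div_card_le_softmax (hl t s) a

theorem pgMinProbSq_pos (hlam : 0 < lam) : 0 < M.pgMinProbSq lam θ₀ := by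
  have := M.nonempty_states
  obtain ⟨κ, hκ, hle⟩ := exists_pos_le_pgPolicy (M := M) θ₀ hlam
  exact (pow_pos hκ 2).trans_le (le_ciInf fun t => le_ciInf fun s => le_ciInf fun a =>
    pow_le_pow_left₀ hκ.le (hle (t + 1) s a) 2)

theorem objective_pgPolicy_add_le_succ (hlam : 0 ≤ lam) :
    M.objective lam (M.pgPolicy lam θ₀ t) + 3 / 4 * M.pgRate lam *
        ‖M.policyGradient lam (M.pgParam lam (M.pgRate lam) θ₀ t)‖ ^ 2 ≤
      M.objective lam (M.pgPolicy lam θ₀ (t + 1)) := by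
  rw [pgPolicy, pgPolicy, pgParam_succ _ _ hlam]
  exact add_norm_sq_le_apply_gradient_step
    (f := fun θ : EuclideanSpace ℝ (S × A) => M.objective lam (softmaxPolicy θ))
    (M.pgRate_pos hlam) (objective_softmaxPolicy_add_ge hlam _)

end Iteration

end Iterates

section Convergence

variable {S A : Type*} [Fintype S] [DecidableEq S] [Fintype A] {M : FiniteMDP S A}
  {lam : ℝ} {πstar : S → A → ℝ}

theorem IsOptimalPolicy.init_mul_value_sub_le (h : M.IsOptimalPolicy lam πstar)
    (hμ : ∀ s, 0 < M.μ s) {π : S → A → ℝ} (hπ : IsPolicy π) (s : S) :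
    M.μ s * (M.value lam πstar s - M.value lam π s) ≤
      M.objective lam πstar - M.objective lam π := by
  rw [objective_sub_objective_eq_dotProduct]
  exact Finset.single_le_sum
    (f := fun s => M.μ s * (M.value lam πstar - M.value lam π) s)
    (fun i _ => mul_nonneg (hμ i).le (sub_nonneg.2 (h.value_le hμ hπ i))) (Finset.mem_univ s)

theorem pgConst_mul_card_mul_norm_eq (hμ : ∀ s, 0 < M.μ s) (hlam : 0 < lam)
    (hstar : IsPolicy πstar) (θ₀ : EuclideanSpace ℝ (S × A)) :
    M.pgConst lam πstar θ₀ * (Fintype.card S * ‖fun s => M.visitation πstar s / M.μ s‖) =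
      lam * (1 - M.γ) * (⨅ s, M.μ s) * M.pgMinProbSq lam θ₀ * M.pgRate lam := by
  have := M.nonempty_states
  have hmismatch := M.one_sub_discount_pos.trans_le
    (one_sub_discount_le_norm_visitation_div hμ hstar)
  have hlog := Real.log_natCast_nonneg (Fintype.card A)
  have : (0 : ℝ) < Fintype.card S := Nat.cast_pos.2 Fintype.card_pos
  rw [pgConst, pgRate]
  generalize Real.log (Fintype.card A) = H at hlog ⊢
  have hden : 8 / lam + 4 + 8 * H = (8 + lam * (4 + 8 * H)) / lam := by
    field_simp
    ring
  rw [hden]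
  have : 0 < 8 + lam * (4 + 8 * H) := by positivity
  field_simp

variable [Nonempty A] (hμ : ∀ s, 0 < M.μ s) (hlam : 0 < lam) (θ₀ : EuclideanSpace ℝ (S × A))

include hμ hlam

section Rate

variable (hstar : IsPolicy πstar)

include hstar

theorem pgConst_pos : 0 < M.pgConst lam πstar θ₀ := by
  have := M.nonempty_states
  have hmin := pgMinProbSq_pos (M := M) θ₀ hlam
  have hx := M.one_sub_discount_pos
  have hinit := iInf_init_pos hμ
  have hmismatch := hx.trans_le (one_sub_discount_le_norm_visitation_div hμ hstar)
  have := Real.log_natCast_nonneg (Fintype.card A)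
  have : (0 : ℝ) < Fintype.card S := Nat.cast_pos.2 Fintype.card_pos
  rw [pgConst]
  positivity

theorem pgConst_le_one_div_four : M.pgConst lam πstar θ₀ ≤ 1 / 4 := by
  have := M.nonempty_states
  have hx := M.one_sub_discount_pos
  have hD := one_sub_discount_le_norm_visitation_div hμ hstar
  have hcard : (1 : ℝ) ≤ Fintype.card S := Nat.one_le_cast.2 Fintype.card_pos
  have hmin := mul_le_one₀ ((M.iInf_init_le _).trans (M.init_le_one (Classical.arbitrary S)))
    (pgMinProbSq_pos (M := M) θ₀ hlam).le (M.pgMinProbSq_le_one lam θ₀)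
  have hrate := mul_nonneg hlam.le (M.pgRate_pos hlam.le).le
  refine le_trans (le_of_mul_le_mul_right ?_ hx) (M.mul_pgRate_le_one_div_four hlam.le)
  calc M.pgConst lam πstar θ₀ * (1 - M.γ)
      ≤ M.pgConst lam πstar θ₀ *
          (Fintype.card S * ‖fun s => M.visitation πstar s / M.μ s‖) :=
        mul_le_mul_of_nonneg_left (hD.trans (le_mul_of_one_le_left (norm_nonneg _) hcard))
          (pgConst_pos hμ hlam θ₀ hstar).le
    _ = lam * M.pgRate lam * (1 - M.γ) * ((⨅ s, M.μ s) * M.pgMinProbSq lam θ₀) := by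
        rw [pgConst_mul_card_mul_norm_eq hμ hlam hstar θ₀]
        ring
    _ ≤ lam * M.pgRate lam * (1 - M.γ) :=
        mul_le_of_le_one_right (mul_nonneg hrate hx.le) hmin

/-- The contraction only starts at the first iterate; as `T ≥ 4`, the factor `3 / 2` in its rate
makes up for the lost iteration. -/
theorem exists_eq_succ_and_log_le_of_pgTime_le {T : ℕ} (hT : M.pgTime lam πstar θ₀ ≤ T) :
    ∃ t : ℕ, T = t + 1 ∧ Real.log (4 * ‖fun s => 1 / M.μ s‖ / (1 - M.γ)) ≤
      3 / 2 * M.pgConst lam πstar θ₀ * t := by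
  have hC := pgConst_pos hμ hlam θ₀ hstar
  have hC₄ := pgConst_le_one_div_four hμ hlam θ₀ hstar
  have hE := four_le_norm_one_div_init_div hμ
  have hlog : 1 ≤ Real.log (4 * ‖fun s => 1 / M.μ s‖ / (1 - M.γ)) := by
    rw [Real.le_log_iff_exp_le (by linarith)]
    linarith [Real.exp_one_lt_three]
  rw [pgTime, one_div, inv_mul_le_iff₀ hC] at hT
  have hT₄ : (4 : ℝ) ≤ T := by
    have := mul_le_mul_of_nonneg_right hC₄ (Nat.cast_nonneg (α := ℝ) T)
    linarith
  obtain ⟨t, rfl⟩ : ∃ t, T = t + 1 := Nat.exists_eq_succ_of_ne_zero fun h => by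
    norm_num [h] at hT₄
  refine ⟨t, rfl, hT.trans ?_⟩
  push_cast at hT₄ ⊢
  have ht : (t : ℝ) + 1 ≤ 3 / 2 * t := by linarith
  exact (mul_le_mul_of_nonneg_left ht hC.le).trans_eq (by ring)

end Rate

theorem pgConst_mul_suboptimality_le (hstar : M.IsOptimalPolicy lam πstar) (t : ℕ) :
    2 * M.pgConst lam πstar θ₀ *
        (M.objective lam πstar - M.objective lam (M.pgPolicy lam θ₀ (t + 1))) ≤
      M.pgRate lam * ‖M.policyGradient lam (M.pgParam lam (M.pgRate lam) θ₀ (t + 1))‖ ^ 2 := by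
  have := M.nonempty_states
  set θ := M.pgParam lam (M.pgRate lam) θ₀ (t + 1)
  have hδ := sub_nonneg.2 (hstar.2 _ (isPolicy_softmaxPolicy θ))
  have hC := (pgConst_pos hμ hlam θ₀ hstar.1).le
  have hD := M.one_sub_discount_pos.trans_le
    (one_sub_discount_le_norm_visitation_div hμ hstar.1)
  have hcard : (1 : ℝ) ≤ Fintype.card S := Nat.one_le_cast.2 Fintype.card_pos
  have hgrad := mul_le_mul_of_nonneg_left (objective_sub_objective_le_norm_policyGradient_sq
    (θ := θ) hμ hlam (iInf_init_pos hμ).le M.iInf_init_le (pgMinProbSq_pos θ₀ hlam).le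
    (M.pgMinProbSq_le lam θ₀ t) hstar.1) (M.pgRate_pos hlam.le).le
  have hconst := pgConst_mul_card_mul_norm_eq hμ hlam hstar.1 θ₀
  change 2 * _ * (M.objective lam πstar - M.objective lam (softmaxPolicy θ)) ≤ _
  generalize M.objective lam πstar - M.objective lam (softmaxPolicy θ) = δ at hδ hgrad ⊢
  generalize ‖fun s => M.visitation πstar s / M.μ s‖ = D at hD hgrad hconst
  refine le_of_mul_le_mul_right ?_ hD
  calc 2 * M.pgConst lam πstar θ₀ * δ * D
      ≤ Fintype.card S * (2 * M.pgConst lam πstar θ₀ * δ * D) :=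
        le_mul_of_one_le_left (by positivity) hcard
    _ = 2 * (M.pgConst lam πstar θ₀ * (Fintype.card S * D)) * δ := by ring
    _ ≤ _ := by
        rw [hconst]
        linarith

theorem suboptimality_pgPolicy_add_two_le (hstar : M.IsOptimalPolicy lam πstar) (t : ℕ) :
    M.objective lam πstar - M.objective lam (M.pgPolicy lam θ₀ (t + 2)) ≤
      (1 - 3 / 2 * M.pgConst lam πstar θ₀) *
        (M.objective lam πstar - M.objective lam (M.pgPolicy lam θ₀ (t + 1))) := by
  have hascent := objective_pgPolicy_add_le_succ (M := M) θ₀ (t + 1) hlam.le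
  have hgrad := pgConst_mul_suboptimality_le hμ hlam θ₀ hstar t
  linarith

theorem suboptimality_pgPolicy_succ_le (hstar : M.IsOptimalPolicy lam πstar) (t : ℕ) :
    M.objective lam πstar - M.objective lam (M.pgPolicy lam θ₀ (t + 1)) ≤
      Real.exp (-(3 / 2 * M.pgConst lam πstar θ₀) * t) *
        (M.objective lam πstar - M.objective lam (M.pgPolicy lam θ₀ 0)) := by
  have hfirst := objective_pgPolicy_add_le_succ (M := M) θ₀ 0 hlam.le
  have hgain : 0 ≤ 3 / 4 * M.pgRate lam *
      ‖M.policyGradient lam (M.pgParam lam (M.pgRate lam) θ₀ 0)‖ ^ 2 :=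
    mul_nonneg (mul_nonneg (by norm_num) (M.pgRate_pos hlam.le).le) (sq_nonneg _)
  refine (le_exp_neg_mul_of_succ_le
    (u := fun t => M.objective lam πstar - M.objective lam (M.pgPolicy lam θ₀ (t + 1)))
    (fun t => sub_nonneg.2 (hstar.2 _ (isPolicy_softmaxPolicy _)))
    (suboptimality_pgPolicy_add_two_le hμ hlam θ₀ hstar) t).trans
    (mul_le_mul_of_nonneg_left ?_ (Real.exp_pos _).le)
  rw [zero_add] at hfirst ⊢
  linarith

theorem satisfiesPropI_pgPolicy (hstar : M.IsOptimalPolicy lam πstar) :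
    M.SatisfiesPropI lam πstar (M.pgPolicy lam) (M.pgTime lam πstar) 0 := by
  intro θ₀ T hT s
  obtain ⟨t, rfl, hlog⟩ := exists_eq_succ_and_log_le_of_pgTime_le hμ hlam θ₀ hstar.1 hT
  set N := ‖fun s => 1 / M.μ s‖
  set q := Real.exp (-(3 / 2 * M.pgConst lam πstar θ₀ * t))
  set δ₀ := M.objective lam πstar - M.objective lam (M.pgPolicy lam θ₀ 0)
  set gap := M.value lam πstar s - M.value lam (M.pgPolicy lam θ₀ (t + 1)) s
  have hπ : IsPolicy (M.pgPolicy lam θ₀ (t + 1)) := isPolicy_softmaxPolicy _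
  have hgap : 0 ≤ gap := sub_nonneg.2 (hstar.value_le hμ hπ s)
  have hδ₀ : 0 ≤ δ₀ := sub_nonneg.2 (hstar.2 _ (isPolicy_softmaxPolicy _))
  have hdecay : M.μ s * gap ≤ q * δ₀ :=
    (hstar.init_mul_value_sub_le hμ hπ s).trans
      (by simpa only [neg_mul] using suboptimality_pgPolicy_succ_le hμ hlam θ₀ hstar t)
  have hfactor : 4 * N * q ≤ 1 := four_mul_norm_mul_exp_le_one hμ hlog
  have hfour : 4 * gap ≤ δ₀ :=
    calc 4 * gap ≤ M.μ s * N * (4 * gap) :=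
          le_mul_of_one_le_left (by positivity) (one_le_init_mul_norm_one_div_init hμ s)
      _ = 4 * N * (M.μ s * gap) := by ring
      _ ≤ 4 * N * (q * δ₀) := mul_le_mul_of_nonneg_left hdecay (by positivity)
      _ = 4 * N * q * δ₀ := by ring
      _ ≤ δ₀ := mul_le_of_le_one_left hδ₀ hfactor
  linarith

end Convergence

end FiniteMDP

end

theorem mainTheorem12 {S A : Type*} [Fintype S] [DecidableEq S] [Fintype A] [Nonempty A]
    (M : FiniteMDP S A) (hμ : ∀ s, 0 < M.μ s) (lam : ℝ) (hlam : 0 < lam) :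
    (∃ πstar : S → A → ℝ, M.IsOptimalPolicy lam πstar) ∧
    ∀ πstar : S → A → ℝ, M.IsOptimalPolicy lam πstar →
      (∀ θ₀ : EuclideanSpace ℝ (S × A), 0 < M.pgConst lam πstar θ₀) ∧
      M.SatisfiesPropI lam πstar (M.pgPolicy lam) (M.pgTime lam πstar) 0 :=
  ⟨M.exists_isOptimalPolicy lam, fun _ hstar =>
    ⟨fun θ₀ => FiniteMDP.pgConst_pos hμ hlam θ₀ hstar.1,
      FiniteMDP.satisfiesPropI_pgPolicy hμ hlam hstar⟩⟩
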